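/- Let $q:\mathbb R\to\mathbb R$ be locally integrable with $q\ge 0$ almost everywhere, and suppose that $\int_{-\infty}^x q(t)\,dt>0$ and $\int_x^\infty q(t)\,dt>0$ for every $x\in\mathbb R$. For $x\in\mathbb R$ let $d(x)$ denote the unique solution $d>0$ of $$\int_0^{\sqrt2\,d}\int_{x-t}^{x+t}q(\xi)\,d\xi\,dt=2,$$ and put $q^*(x)=d(x)^{-2}$. Suppose that $q\in H$, i.e. $$\lim_{|x|\to\infty} d(x)\int_0^{\sqrt2\,d(x)}\bigl(q(x+t)-q(x-t)\bigr)\,dt=0,$$ and that $$\sup_{x\in\mathbb R}d(x)=\infty,\qquad \int_{-\infty}^0 q^*(x)\,dx=\int_0^\infty q^*(x)\,dx=\infty .$$ For $p\in[1,\infty)$ and a weight (a positive continuous function) $\mu$ on $\mathbb R$ let $L_{p,\mu}$ be the space of all real functions $f\in L_p^{\rm loc}(\mathbb R)$ with $\|f\|_{p,\mu}=\bigl(\int_{\mathbb R}|\mu f|^p\,dx\bigr)^{1/p}<\infty$, and $L_p=L_{p,1}$. A solution of $$-y''(x)+q(x)y(x)=f(x),\quad x\in\mathbb R,\tag{1}$$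 is a differentiable function $y$ such that $y$ and $y'$ are absolutely continuous on every finite segment and (1) holds almost everywhere. For weights $\mu,\theta$ the pair $\{L_{p,\mu};L_{p,\theta}\}$ is called admissible for (1) if for every $f\in L_{p,\theta}$ there is exactly one solution $y\in L_{p,\mu}$ of (1), and there is a constant $c\in(0,\infty)$, independent of $f$, such that $\|y\|_{p,\mu}\le c\,\|f\|_{p,\theta}$ for all $f\in L_{p,\theta}$. Then: A) for every $p\in[1,\infty)$ the pair $\{L_p;L_p\}$ is not admissible for (1); B) for every $p\in[1,\infty)$ the function $q^*$ is a weight and the pair $\{L_{p,q^*};L_p\}$ is admissible for (1). -/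

import Mathlib

open MeasureTheory Set Filter Topology
open scoped ENNReal

namespace SturmLiouville

/-- The function `η ↦ ∫₀^{√2 η} ∫_{x-t}^{x+t} q(ξ) dξ dt`. -/
noncomputable def F (q : ℝ → ℝ) (x η : ℝ) : ℝ :=
  ∫ t in (0 : ℝ)..(Real.sqrt 2 * η), ∫ ξ in (x - t)..(x + t), q ξ

/-- Condition `∫_{-∞}^x q > 0` and `∫_x^∞ q > 0` for all real `x`.  The integrals of the
nonnegative function `q` may be infinite, hence are taken with values in `[0, ∞]`. -/
def PositiveTails (q : ℝ → ℝ) : Prop :=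
  ∀ x : ℝ, 0 < ∫⁻ t in Iic x, ENNReal.ofReal (q t) ∧ 0 < ∫⁻ t in Ici x, ENNReal.ofReal (q t)

/-- The auxiliary function `d`: for each `x`, the solution `d ≥ 0` of
`∫₀^{√2 d} ∫_{x-t}^{x+t} q(ξ) dξ dt = 2`.  It exists, is unique and is positive under the standing
assumptions on `q`, see `existsUnique_F_eq_two` and `d_spec` below, so the infimum below is taken
over a one-point set. -/
noncomputable def d (q : ℝ → ℝ) (x : ℝ) : ℝ :=
  sInf {η : ℝ | 0 ≤ η ∧ F q x η = 2}

/-- The function `q* = d⁻²`. -/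
noncomputable def qStar (q : ℝ → ℝ) (x : ℝ) : ℝ := 1 / (d q x) ^ 2

/-- The function `ν(x) = d(x) ∫₀^{√2 d(x)} (q(x+t) - q(x-t)) dt`. -/
noncomputable def nu (q : ℝ → ℝ) (x : ℝ) : ℝ :=
  d q x * ∫ t in (0 : ℝ)..(Real.sqrt 2 * d q x), (q (x + t) - q (x - t))

/-- The class `H`: `ν(x) → 0` as `|x| → ∞`. -/
def InClassH (q : ℝ → ℝ) : Prop := Tendsto (nu q) (atBot ⊔ atTop) (𝓝 0)

/-- Weights are positive continuous functions on the real line. -/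
def IsWeight (μ : ℝ → ℝ) : Prop := Continuous μ ∧ ∀ x, 0 < μ x

/-- `f ∈ L_{p,μ}`: `f` is locally in `L_p` and `∫ |μ f|^p < ∞`. -/
def MemWeightedLp (p : ℝ≥0∞) (μ f : ℝ → ℝ) : Prop :=
  (∀ K : Set ℝ, IsCompact K → MemLp f p (volume.restrict K)) ∧
    MemLp (fun x => μ x * f x) p volume

/-- The norm `‖f‖_{p,μ} = (∫ |μ f|^p)^{1/p}`, with values in `[0, ∞]`. -/
noncomputable def weightedNorm (p : ℝ≥0∞) (μ f : ℝ → ℝ) : ℝ≥0∞ :=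
  eLpNorm (fun x => μ x * f x) p volume

/-- `y` is a solution of `-y'' + q y = f`: `y` is differentiable, `y` and `y'` are absolutely
continuous on every finite segment, and the equation holds almost everywhere. -/
def IsSolution (q f y : ℝ → ℝ) : Prop :=
  Differentiable ℝ y ∧
  (∀ a b : ℝ, AbsolutelyContinuousOnInterval y a b) ∧
  (∀ a b : ℝ, AbsolutelyContinuousOnInterval (deriv y) a b) ∧
  ∀ᵐ x : ℝ, -deriv (deriv y) x + q x * y x = f x

/-- The pair `{L_{p,μ}; L_{p,θ}}` (`μ`, `θ` weights) is admissible for `-y'' + q y = f`: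
every `f ∈ L_{p,θ}` has exactly one solution `y ∈ L_{p,μ}`, and `‖y‖_{p,μ} ≤ c ‖f‖_{p,θ}`
with a finite constant `c` independent of `f`. -/
def Admissible (q : ℝ → ℝ) (p : ℝ≥0∞) (μ θ : ℝ → ℝ) : Prop :=
  IsWeight μ ∧ IsWeight θ ∧
  (∀ f : ℝ → ℝ, MemWeightedLp p θ f → ∃! y : ℝ → ℝ, IsSolution q f y ∧ MemWeightedLp p μ y) ∧
  ∃ c : ℝ, 0 < c ∧ ∀ f y : ℝ → ℝ, MemWeightedLp p θ f → IsSolution q f y → MemWeightedLp p μ y →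
    weightedNorm p μ y ≤ ENNReal.ofReal c * weightedNorm p θ f

/-- Existence, uniqueness and positivity of the value `d(x)`. -/
theorem existsUnique_F_eq_two {q : ℝ → ℝ} (hq : LocallyIntegrable q volume)
    (hq0 : ∀ᵐ x : ℝ, 0 ≤ q x) (ht : PositiveTails q) (x : ℝ) :
    ∃ η : ℝ, 0 < η ∧ {η : ℝ | 0 ≤ η ∧ F q x η = 2} = {η} := by
  have hii : ∀ a b : ℝ, IntervalIntegrable q volume a b := fun a b =>
    (hq.integrableOn_isCompact isCompact_uIcc).intervalIntegrable
  set g : ℝ → ℝ := fun t => ∫ ξ in (x - t)..(x + t), q ξ with hg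
  have hgP : ∀ t, g t = (∫ ξ in (0 : ℝ)..(x + t), q ξ) - ∫ ξ in (0 : ℝ)..(x - t), q ξ :=
    fun t => (intervalIntegral.integral_interval_sub_left (hii _ _) (hii _ _)).symm
  have hP : Continuous fun b => ∫ ξ in (0 : ℝ)..b, q ξ :=
    intervalIntegral.continuous_primitive hii 0
  have hgc : Continuous g := by
    have : g = fun t => (∫ ξ in (0 : ℝ)..(x + t), q ξ) - ∫ ξ in (0 : ℝ)..(x - t), q ξ :=
      funext hgP
    rw [this]
    exact (hP.comp (by fun_prop : Continuous fun t => x + t)).sub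
      (hP.comp (by fun_prop : Continuous fun t => x - t))
  have hPm : Monotone fun b => ∫ ξ in (0 : ℝ)..b, q ξ := by
    intro a b hab
    have h1 := intervalIntegral.integral_interval_sub_left (hii 0 b) (hii 0 a)
    have h2 : 0 ≤ ∫ ξ in a..b, q ξ :=
      intervalIntegral.integral_nonneg_of_ae hab hq0
    simp only
    linarith
  have hgm : Monotone g := by
    intro s t hst
    rw [hgP, hgP]
    have h1 := hPm (by linarith : x + s ≤ x + t)
    have h2 := hPm (by linarith : x - t ≤ x - s)
    simp only at h1 h2
    linarith
  have hg00 : g 0 = 0 := by simp [hg]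
  have hg0 : ∀ t, 0 ≤ t → 0 ≤ g t := fun t h => hg00 ▸ hgm h
  have hgi : ∀ a b : ℝ, IntervalIntegrable g volume a b := fun a b => hgc.intervalIntegrable a b
  have hs : 0 < Real.sqrt 2 := by positivity
  have hFs : ∀ a b : ℝ, a ≤ b → F q x a + Real.sqrt 2 * (b - a) * g (Real.sqrt 2 * a) ≤ F q x b := by
    intro a b hab
    have hab' : Real.sqrt 2 * a ≤ Real.sqrt 2 * b := by gcongr
    have h1 : F q x b - F q x a = ∫ t in (Real.sqrt 2 * a)..(Real.sqrt 2 * b), g t :=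
      intervalIntegral.integral_interval_sub_left (hgi _ _) (hgi _ _)
    have h2 : ∫ t in (Real.sqrt 2 * a)..(Real.sqrt 2 * b), g (Real.sqrt 2 * a) ≤
        ∫ t in (Real.sqrt 2 * a)..(Real.sqrt 2 * b), g t :=
      intervalIntegral.integral_mono_on hab' (by simp) (hgi _ _) fun t h => hgm h.1
    rw [intervalIntegral.integral_const, smul_eq_mul] at h2
    nlinarith
  have hF0 : F q x 0 = 0 := by simp [F]
  have hFup : ∀ a : ℝ, 0 ≤ a → F q x a ≤ Real.sqrt 2 * a * g (Real.sqrt 2 * a) := by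
    intro a ha
    have h2 : ∫ t in (0 : ℝ)..(Real.sqrt 2 * a), g t ≤
        ∫ t in (0 : ℝ)..(Real.sqrt 2 * a), g (Real.sqrt 2 * a) :=
      intervalIntegral.integral_mono_on (by positivity) (hgi _ _) (by simp) fun t h => hgm h.2
    rw [intervalIntegral.integral_const, smul_eq_mul, sub_zero] at h2
    exact h2
  have hFc : Continuous (F q x) :=
    (intervalIntegral.continuous_primitive hgi 0).comp
      (by fun_prop : Continuous fun η : ℝ => Real.sqrt 2 * η)
  obtain ⟨T, hT0, hT⟩ : ∃ T : ℝ, 0 < T ∧ 0 < g (Real.sqrt 2 * T) := by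
    by_contra! hcon
    have hz : ∀ n : ℕ, ∀ᵐ t ∂(volume.restrict (Icc x (x + n))), ENNReal.ofReal (q t) = 0 := by
      intro n
      have h0 : ∫ ξ in x..(x + n), q ξ = 0 := by
        rcases n.eq_zero_or_pos with rfl | hn
        · simp
        have hn' : (0 : ℝ) < n := by exact_mod_cast hn
        have h1 : g n ≤ 0 := by
          have := hcon (n / Real.sqrt 2) (by positivity)
          rwa [mul_div_cancel₀ _ hs.ne'] at this
        have h2 : (0 : ℝ) ≤ ∫ ξ in x..(x + n), q ξ :=
          intervalIntegral.integral_nonneg_of_ae (by linarith) hq0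
        have h3 : (0 : ℝ) ≤ ∫ ξ in (x - n)..x, q ξ :=
          intervalIntegral.integral_nonneg_of_ae (by linarith) hq0
        have h4 : (∫ ξ in (x - n)..x, q ξ) + ∫ ξ in x..(x + n), q ξ = g n :=
          intervalIntegral.integral_add_adjacent_intervals (hii _ _) (hii _ _)
        linarith
      have hn0 : (0 : ℝ) ≤ n := n.cast_nonneg
      rw [intervalIntegral.integral_of_le (by linarith), ← integral_Icc_eq_integral_Ioc,
        integral_eq_zero_iff_of_nonneg_ae (ae_restrict_of_ae hq0)
          (hq.integrableOn_isCompact isCompact_Icc)] at h0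
      filter_upwards [h0] with t h
      simp [h]
    have hU : (⋃ n : ℕ, Icc x (x + n)) = Ici x := by
      ext t
      simp only [mem_iUnion, mem_Icc, mem_Ici]
      refine ⟨fun ⟨n, h⟩ => h.1, fun h => ?_⟩
      obtain ⟨n, hn⟩ := exists_nat_ge (t - x)
      exact ⟨n, h, by linarith⟩
    have hz' : ∀ᵐ t ∂(volume.restrict (Ici x)), ENNReal.ofReal (q t) = 0 := by
      rw [← hU, ae_restrict_iUnion_iff]
      exact hz
    have := (ht x).2
    rw [lintegral_congr_ae hz'] at this
    simp at this
  obtain ⟨η, hη, hη2⟩ : ∃ η : ℝ, 0 ≤ η ∧ F q x η = 2 := by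
    have hc : 0 < Real.sqrt 2 * g (Real.sqrt 2 * T) := by positivity
    set B : ℝ := T + 2 / (Real.sqrt 2 * g (Real.sqrt 2 * T)) with hB
    have hTB : T ≤ B := by rw [hB]; linarith [div_pos two_pos hc]
    have h1 := hFs T B hTB
    have h2 := hFs 0 T hT0.le
    have h3 : Real.sqrt 2 * (B - T) * g (Real.sqrt 2 * T) = 2 := by
      have : B - T = 2 / (Real.sqrt 2 * g (Real.sqrt 2 * T)) := by rw [hB]; ring
      rw [this]
      field_simp
    rw [mul_zero, hg00, hF0] at h2
    have := intermediate_value_Icc (hT0.le.trans hTB) hFc.continuousOn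
    obtain ⟨η, h, h'⟩ := this (show (2 : ℝ) ∈ Icc (F q x 0) (F q x B) by
      rw [hF0]; constructor <;> linarith)
    exact ⟨η, h.1, h'⟩
  have hlt : ∀ a b : ℝ, 0 ≤ a → a < b → F q x a = 2 → F q x b = 2 → False := by
    intro a b ha hab h1 h2
    have h3 := hFs a b hab.le
    have h4 := hFup a ha
    have h5 : 0 < g (Real.sqrt 2 * a) := by
      by_contra hle
      have : Real.sqrt 2 * a * g (Real.sqrt 2 * a) ≤ 0 :=
        mul_nonpos_of_nonneg_of_nonpos (by positivity) (not_lt.mp hle)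
      linarith
    have h6 : 0 < Real.sqrt 2 * (b - a) * g (Real.sqrt 2 * a) :=
      mul_pos (mul_pos hs (sub_pos.mpr hab)) h5
    linarith
  refine ⟨η, lt_of_le_of_ne hη ?_, ?_⟩
  · rintro rfl
    rw [hF0] at hη2
    norm_num at hη2
  · ext b
    simp only [mem_ofPred_eq, mem_singleton_iff]
    constructor
    · rintro ⟨hb, hb2⟩
      rcases lt_trichotomy b η with h | h | h
      · exact (hlt b η hb h hb2 hη2).elim
      · exact h
      · exact (hlt η b hη h hη2 hb2).elim
    · rintro rfl
      exact ⟨hη, hη2⟩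

/-- `d(x)` is the unique nonnegative root of its defining equation, and it is positive. -/
theorem d_spec {q : ℝ → ℝ} (hq : LocallyIntegrable q volume)
    (hq0 : ∀ᵐ x : ℝ, 0 ≤ q x) (ht : PositiveTails q) (x : ℝ) :
    0 < d q x ∧ F q x (d q x) = 2 ∧ ∀ η : ℝ, 0 ≤ η → F q x η = 2 → η = d q x := by
  obtain ⟨η, hη, hs⟩ := existsUnique_F_eq_two hq hq0 ht x
  have hd : d q x = η := by rw [d, hs, csInf_singleton]
  have hm : η ∈ {η : ℝ | 0 ≤ η ∧ F q x η = 2} := by rw [hs]; rfl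
  rw [hd]
  refine ⟨hη, hm.2, fun b hb hb2 => ?_⟩
  have : b ∈ {η : ℝ | 0 ≤ η ∧ F q x η = 2} := ⟨hb, hb2⟩
  rwa [hs] at this

end SturmLiouville

/-! The function `s = √2 d` has Lipschitz constant `1`, and implicit differentiation of its
defining equation bounds `s'` by `ν`; in the class `H` it is therefore slowly varying. A positive
solution `u` of `u'' = q u` increasing from `-∞` satisfies `u ≤ 3 s u'` near infinity, because
`q` has mass of order `1 / s` on the interval of length `s` to the left of a point. Hence `u`
grows exponentially at the length scale `s`, and so does the solution `v` obtained after
reflection in the origin. By the Schur test the Green function `u (min x t) v (-max x t) / W`,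
weighted by `2 / s x ^ 2 = q* x`, is bounded on every `L_p`, and uniqueness holds since
`u / s ^ 2` is unbounded.

For the negative result, a solution of the homogeneous equation, cut off to an interval of length
comparable to a large value `d x₀`, solves the equation with a right-hand side of size
`d x₀ ^ (-2)` on that interval. -/

namespace SturmLiouville

/-! ### Primitives and the homogeneous equation -/

theorem locallyIntegrable_iff_intervalIntegrable {g : ℝ → ℝ} :
    LocallyIntegrable g volume ↔ ∀ a b : ℝ, IntervalIntegrable g volume a b := by
  refine ⟨fun hg a b => (hg.integrableOn_isCompact isCompact_uIcc).intervalIntegrable,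
    fun hg x => ⟨Icc (x - 1) (x + 1), Icc_mem_nhds (by simp) (by simp), ?_⟩⟩
  exact (intervalIntegrable_iff_integrableOn_Icc_of_le (by linarith)).1 (hg _ _)

theorem locallyIntegrable_comp_neg {g : ℝ → ℝ} (hg : LocallyIntegrable g volume) :
    LocallyIntegrable (fun x => g (-x)) volume :=
  (locallyIntegrable_map_homeomorph (Homeomorph.neg ℝ)).1
    (by simpa [Measure.map_neg_eq_self] using hg)

theorem ae_nonneg_comp_neg {q : ℝ → ℝ} (hq0 : ∀ᵐ x : ℝ, 0 ≤ q x) : ∀ᵐ x : ℝ, 0 ≤ q (-x) :=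
  (Measure.measurePreserving_neg volume).quasiMeasurePreserving.ae hq0

/-- `y` is an indefinite integral of the locally integrable function `g`; equivalently, `y` is
locally absolutely continuous and `y' = g` almost everywhere. -/
structure IsPrimitive (y g : ℝ → ℝ) : Prop where
  locallyIntegrable : LocallyIntegrable g volume
  integral_eq_sub : ∀ a b : ℝ, ∫ t in a..b, g t = y b - y a

namespace IsPrimitive

variable {y g w h : ℝ → ℝ}

theorem intervalIntegrable (hy : IsPrimitive y g) (a b : ℝ) : IntervalIntegrable g volume a b :=
  locallyIntegrable_iff_intervalIntegrable.1 hy.locallyIntegrable a b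

theorem eq_add_integral (hy : IsPrimitive y g) (a x : ℝ) : y x = y a + ∫ t in a..x, g t := by
  rw [hy.integral_eq_sub a x]; ring

theorem eq_fun_add_integral (hy : IsPrimitive y g) (a : ℝ) :
    y = fun x => y a + ∫ t in a..x, g t :=
  funext (hy.eq_add_integral a)

theorem absolutelyContinuousOnInterval (hy : IsPrimitive y g) (a b : ℝ) :
    AbsolutelyContinuousOnInterval y a b := by
  have hconst : AbsolutelyContinuousOnInterval (fun _ : ℝ => y a) a b :=
    ((LipschitzWith.const (y a)).lipschitzOnWith (s := uIcc a b)).absolutelyContinuousOnInterval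
  have hint := (hy.intervalIntegrable a b).absolutelyContinuousOnInterval_intervalIntegral
    (c := a) left_mem_uIcc
  rw [hy.eq_fun_add_integral a]
  exact hconst.add hint

theorem ae_hasDerivAt (hy : IsPrimitive y g) : ∀ᵐ x : ℝ, HasDerivAt y (g x) x := by
  filter_upwards [LocallyIntegrable.ae_hasDerivAt_integral hy.locallyIntegrable] with x hx
  rw [hy.eq_fun_add_integral 0]
  exact (hx 0).const_add (y 0)

theorem continuous (hy : IsPrimitive y g) : Continuous y := by
  rw [hy.eq_fun_add_integral 0]
  exact (intervalIntegral.continuous_primitive hy.intervalIntegrable 0).const_add (y 0)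

theorem hasDerivAt (hy : IsPrimitive y g) (hg : Continuous g) (x : ℝ) :
    HasDerivAt y (g x) x := by
  rw [hy.eq_fun_add_integral 0]
  exact (intervalIntegral.integral_hasDerivAt_right (hy.intervalIntegrable 0 x)
    (hg.stronglyMeasurableAtFilter _ _) hg.continuousAt).const_add (y 0)

theorem congr_ae (hy : IsPrimitive y g) (hgh : ∀ᵐ x : ℝ, g x = h x) : IsPrimitive y h where
  locallyIntegrable := hy.locallyIntegrable.congr hgh
  integral_eq_sub a b := by
    rw [← hy.integral_eq_sub a b]
    exact intervalIntegral.integral_congr_ae (hgh.mono fun x hx _ => hx.symm)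

theorem of_absolutelyContinuous (hy : ∀ a b : ℝ, AbsolutelyContinuousOnInterval y a b) :
    IsPrimitive y (deriv y) where
  locallyIntegrable :=
    locallyIntegrable_iff_intervalIntegrable.2 fun a b => (hy a b).intervalIntegrable_deriv
  integral_eq_sub a b := (hy a b).integral_deriv_eq_sub

theorem of_hasDerivAt (hy : ∀ x, HasDerivAt y (g x) x) (hg : Continuous g) :
    IsPrimitive y g where
  locallyIntegrable := hg.locallyIntegrable
  integral_eq_sub a b :=
    intervalIntegral.integral_eq_sub_of_hasDerivAt (fun x _ => hy x) (hg.intervalIntegrable a b)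

theorem of_locallyIntegrable (hg : LocallyIntegrable g volume) (a : ℝ) :
    IsPrimitive (fun x => ∫ t in a..x, g t) g where
  locallyIntegrable := hg
  integral_eq_sub b c :=
    have hg' := locallyIntegrable_iff_intervalIntegrable.1 hg
    (intervalIntegral.integral_interval_sub_left (hg' a c) (hg' a b)).symm

theorem add (hy : IsPrimitive y g) (hw : IsPrimitive w h) :
    IsPrimitive (fun x => y x + w x) (fun x => g x + h x) where
  locallyIntegrable := hy.locallyIntegrable.add hw.locallyIntegrable
  integral_eq_sub a b := by
    rw [intervalIntegral.integral_add (hy.intervalIntegrable a b) (hw.intervalIntegrable a b),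
      hy.integral_eq_sub, hw.integral_eq_sub]
    ring

theorem const_mul (c : ℝ) (hy : IsPrimitive y g) :
    IsPrimitive (fun x => c * y x) (fun x => c * g x) where
  locallyIntegrable := hy.locallyIntegrable.smul c
  integral_eq_sub a b := by
    rw [intervalIntegral.integral_const_mul, hy.integral_eq_sub]; ring

theorem neg (hy : IsPrimitive y g) : IsPrimitive (fun x => -y x) (fun x => -g x) := by
  simpa using hy.const_mul (-1)

theorem sub (hy : IsPrimitive y g) (hw : IsPrimitive w h) :
    IsPrimitive (fun x => y x - w x) (fun x => g x - h x) := by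
  simpa [sub_eq_add_neg] using hy.add hw.neg

theorem comp_neg (hy : IsPrimitive y g) :
    IsPrimitive (fun x => y (-x)) (fun x => -g (-x)) where
  locallyIntegrable := (locallyIntegrable_comp_neg hy.locallyIntegrable).neg
  integral_eq_sub a b := by
    rw [intervalIntegral.integral_neg, intervalIntegral.integral_comp_neg, hy.integral_eq_sub]
    ring

theorem mul (hy : IsPrimitive y g) (hw : IsPrimitive w h) :
    IsPrimitive (fun x => y x * w x) (fun x => g x * w x + y x * h x) := by
  refine (of_absolutelyContinuous fun a b => (hy.absolutelyContinuousOnInterval a b).fun_mul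
    (hw.absolutelyContinuousOnInterval a b)).congr_ae ?_
  filter_upwards [hy.ae_hasDerivAt, hw.ae_hasDerivAt] with x hyx hwx
  exact (hyx.fun_mul hwx).deriv

theorem pow_succ (hy : IsPrimitive y g) (n : ℕ) :
    IsPrimitive (fun x => y x ^ (n + 1)) (fun x => (n + 1) * (g x * y x ^ n)) := by
  induction n with
  | zero => simpa using hy
  | succ n ih =>
    simp_rw [_root_.pow_succ _ (n + 1)]
    exact (ih.mul hy).congr_ae (Eventually.of_forall fun x => by push_cast; ring)

theorem monotone (hy : IsPrimitive y g) (hg : ∀ᵐ x : ℝ, 0 ≤ g x) : Monotone y := by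
  intro a b hab
  rw [← sub_nonneg, ← hy.integral_eq_sub]
  exact intervalIntegral.integral_nonneg_of_ae hab hg

theorem eq_of_deriv_eq_zero (hy : IsPrimitive y g) (hg : ∀ x, g x = 0) (a b : ℝ) :
    y a = y b := by
  simpa [hg] using (hy.eq_add_integral a b).symm

end IsPrimitive

/-- `u` solves the homogeneous equation `u'' = q u` and has derivative `u'`, where `u'` is locally
absolutely continuous. -/
structure IsHomogeneousSolution (q u u' : ℝ → ℝ) : Prop where
  hasDerivAt : ∀ x, HasDerivAt u (u' x) x
  isPrimitive_deriv : IsPrimitive u' fun x => q x * u x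

namespace IsHomogeneousSolution

variable {q u u' v v' : ℝ → ℝ}

theorem continuous (hu : IsHomogeneousSolution q u u') : Continuous u :=
  continuous_iff_continuousAt.2 fun x => (hu.hasDerivAt x).continuousAt

theorem isPrimitive (hu : IsHomogeneousSolution q u u') : IsPrimitive u u' :=
  IsPrimitive.of_hasDerivAt hu.hasDerivAt hu.isPrimitive_deriv.continuous

theorem comp_neg (hu : IsHomogeneousSolution q u u') :
    IsHomogeneousSolution (fun x => q (-x)) (fun x => u (-x)) (fun x => -u' (-x)) where
  hasDerivAt x := by
    simpa [Function.comp_def] using (hu.hasDerivAt (-x)).scomp x (hasDerivAt_neg x)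
  isPrimitive_deriv := by simpa using hu.isPrimitive_deriv.comp_neg.neg

theorem wronskian_eq (hu : IsHomogeneousSolution q u u') (hv : IsHomogeneousSolution q v v')
    (a b : ℝ) : u' a * v a - u a * v' a = u' b * v b - u b * v' b :=
  ((hu.isPrimitive_deriv.mul hv.isPrimitive).sub
    (hu.isPrimitive.mul hv.isPrimitive_deriv)).eq_of_deriv_eq_zero (fun x => by ring) a b

theorem monotone_deriv (hq0 : ∀ᵐ x : ℝ, 0 ≤ q x) (hu : IsHomogeneousSolution q u u')
    (hu0 : ∀ x, 0 ≤ u x) : Monotone u' :=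
  hu.isPrimitive_deriv.monotone (hq0.mono fun x hx => mul_nonneg hx (hu0 x))

end IsHomogeneousSolution

theorem isPrimitive_integral_sub_mul {g : ℝ → ℝ} (hg : LocallyIntegrable g volume) (a : ℝ) :
    IsPrimitive (fun x => ∫ t in a..x, (x - t) * g t) (fun x => ∫ t in a..x, g t) := by
  have hgi := locallyIntegrable_iff_intervalIntegrable.1 hg
  have htg : LocallyIntegrable (fun t => t * g t) volume := hg.continuous_mul continuous_id
  have hid : IsPrimitive (fun x : ℝ => x) fun _ => 1 :=
    IsPrimitive.of_hasDerivAt hasDerivAt_id continuous_const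
  have hsplit : (fun x => ∫ t in a..x, (x - t) * g t) =
      fun x => x * (∫ t in a..x, g t) - ∫ t in a..x, t * g t := by
    funext x
    rw [← intervalIntegral.integral_const_mul, ← intervalIntegral.integral_sub
      ((hgi a x).const_mul x) (locallyIntegrable_iff_intervalIntegrable.1 htg a x)]
    simp_rw [sub_mul]
  rw [hsplit]
  exact ((hid.mul (.of_locallyIntegrable hg a)).sub (.of_locallyIntegrable htg a)).congr_ae
    (Eventually.of_forall fun x => by ring)

/-- The terms of the Picard series of the Cauchy problem `z'' = q z`, `z a = 1`, `z' a = 0`, which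
is the integral equation `z x = 1 + ∫_a^x (x - t) q t z t dt`. -/
noncomputable def picard (q : ℝ → ℝ) (a : ℝ) : ℕ → ℝ → ℝ
  | 0 => fun _ => 1
  | n + 1 => fun x => ∫ t in a..x, (x - t) * (q t * picard q a n t)

section Picard

variable {q : ℝ → ℝ}

theorem picard_comp_neg (q : ℝ → ℝ) (a : ℝ) (n : ℕ) :
    ∀ x, picard (fun t => q (-t)) (-a) n x = picard q a n (-x) := by
  induction n with
  | zero => exact fun _ => rfl
  | succ n ih =>
    intro x
    calc picard (fun t => q (-t)) (-a) (n + 1) x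
        = ∫ t in (-a)..x, (x + -t) * (q (-t) * picard q a n (-t)) := by
          simp only [picard, ih, sub_eq_add_neg]
      _ = ∫ s in (-x)..a, (x + s) * (q s * picard q a n s) := by
          rw [intervalIntegral.integral_comp_neg fun s => (x + s) * (q s * picard q a n s), neg_neg]
      _ = picard q a (n + 1) (-x) := by
          rw [intervalIntegral.integral_symm, ← intervalIntegral.integral_neg]
          exact intervalIntegral.integral_congr fun s _ => by ring

theorem continuous_picard (hq : LocallyIntegrable q volume) (a : ℝ) (n : ℕ) :
    Continuous (picard q a n) := by
  induction n with
  | zero => exact continuous_const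
  | succ n ih => exact (isPrimitive_integral_sub_mul (hq.mul_continuous ih) a).continuous

theorem picard_nonneg_of_le (hq0 : ∀ᵐ x : ℝ, 0 ≤ q x) {a : ℝ} (n : ℕ) :
    ∀ x, a ≤ x → 0 ≤ picard q a n x := by
  induction n with
  | zero => exact fun _ _ => zero_le_one
  | succ n ih =>
    intro x hx
    refine intervalIntegral.integral_nonneg_of_ae_restrict hx ?_
    filter_upwards [ae_restrict_of_ae hq0, ae_restrict_mem measurableSet_Icc] with t hqt ht
    exact mul_nonneg (sub_nonneg.2 ht.2) (mul_nonneg hqt (ih t ht.1))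

theorem picard_le_of_le (hq : LocallyIntegrable q volume) (hq0 : ∀ᵐ x : ℝ, 0 ≤ q x) {a : ℝ}
    (n : ℕ) : ∀ x, a ≤ x →
      picard q a n x ≤ ((x - a) * ∫ t in a..x, q t) ^ n / n.factorial := by
  have hQ := IsPrimitive.of_locallyIntegrable hq a
  set Q : ℝ → ℝ := fun x => ∫ t in a..x, q t
  have hQa : Q a = 0 := intervalIntegral.integral_same
  have hQ0 : ∀ t, a ≤ t → 0 ≤ Q t := fun t ht => hQa ▸ hQ.monotone hq0 ht
  induction n with
  | zero => intro x _; simp [picard]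
  | succ n ih =>
    intro x hx
    have hqQ := hq.mul_continuous (hQ.continuous.pow n)
    have hqp := (hq.mul_continuous (continuous_picard hq a n)).continuous_mul
      (continuous_const.sub continuous_id : Continuous fun t => x - t)
    have hintegral : (n + 1) * ∫ t in a..x, q t * Q t ^ n = Q x ^ (n + 1) := by
      rw [← intervalIntegral.integral_const_mul, (hQ.pow_succ n).integral_eq_sub, hQa]
      simp
    calc picard q a (n + 1) x
        ≤ ∫ t in a..x, ((x - a) ^ (n + 1) / n.factorial) * (q t * Q t ^ n) := by
          refine intervalIntegral.integral_mono_ae_restrict hx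
            (locallyIntegrable_iff_intervalIntegrable.1 hqp a x)
            ((locallyIntegrable_iff_intervalIntegrable.1 hqQ a x).const_mul _) ?_
          filter_upwards [ae_restrict_of_ae hq0, ae_restrict_mem measurableSet_Icc] with t hqt ht
          have hQt := hQ0 t ht.1
          have hpt := picard_nonneg_of_le hq0 n t ht.1
          calc (x - t) * (q t * picard q a n t)
              ≤ (x - a) * (q t * (((x - a) * Q t) ^ n / n.factorial)) := by
                have hta := sub_nonneg.2 ht.1
                have := sub_nonneg.2 ht.2
                gcongr
                · exact ht.1
                · exact (ih t ht.1).trans (by gcongr; exact ht.2)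
            _ = (x - a) ^ (n + 1) / n.factorial * (q t * Q t ^ n) := by rw [mul_pow]; ring
      _ = ((x - a) * Q x) ^ (n + 1) / (n + 1).factorial := by
          rw [intervalIntegral.integral_const_mul, Nat.factorial_succ, mul_pow, ← hintegral]
          push_cast
          field_simp

theorem picard_nonneg (hq0 : ∀ᵐ x : ℝ, 0 ≤ q x) (a : ℝ) (n : ℕ) (x : ℝ) :
    0 ≤ picard q a n x := by
  rcases le_total a x with h | h
  · exact picard_nonneg_of_le hq0 n x h
  · simpa [picard_comp_neg] using picard_nonneg_of_le (ae_nonneg_comp_neg hq0) n (-x) (neg_le_neg h)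

theorem picard_le (hq : LocallyIntegrable q volume) (hq0 : ∀ᵐ x : ℝ, 0 ≤ q x) (a : ℝ) (n : ℕ)
    (x : ℝ) : picard q a n x ≤ ((x - a) * ∫ t in a..x, q t) ^ n / n.factorial := by
  rcases le_total a x with h | h
  · exact picard_le_of_le hq hq0 n x h
  · refine (le_of_eq_of_le (by rw [picard_comp_neg, neg_neg]) (picard_le_of_le
      (locallyIntegrable_comp_neg hq) (ae_nonneg_comp_neg hq0) n (-x) (neg_le_neg h))).trans_eq ?_
    rw [intervalIntegral.integral_comp_neg, intervalIntegral.integral_symm]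
    simp only [neg_neg]
    ring

theorem exists_norm_picard_le (hq : LocallyIntegrable q volume) (hq0 : ∀ᵐ x : ℝ, 0 ≤ q x)
    (a R : ℝ) : ∃ B : ℝ, ∀ n, ∀ x ∈ Metric.closedBall a R,
      ‖picard q a n x‖ ≤ B ^ n / n.factorial := by
  have hcont : Continuous fun x => (x - a) * ∫ t in a..x, q t :=
    (continuous_id.sub continuous_const).mul (IsPrimitive.of_locallyIntegrable hq a).continuous
  obtain ⟨B, hB⟩ :=
    (isCompact_closedBall a R).exists_bound_of_continuousOn hcont.continuousOn
  refine ⟨B, fun n x hx => ?_⟩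
  rw [Real.norm_of_nonneg (picard_nonneg hq0 a n x)]
  calc picard q a n x ≤ ((x - a) * ∫ t in a..x, q t) ^ n / n.factorial := picard_le hq hq0 a n x
    _ ≤ ‖(x - a) * ∫ t in a..x, q t‖ ^ n / n.factorial := by
        gcongr ?_ / _
        rw [← norm_pow]
        exact Real.le_norm_self _
    _ ≤ B ^ n / n.factorial := by gcongr; exact hB x hx

theorem hasSum_picard (hq : LocallyIntegrable q volume) (hq0 : ∀ᵐ x : ℝ, 0 ≤ q x) (a x : ℝ) :
    HasSum (fun n => picard q a n x) (∑' n, picard q a n x) := by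
  obtain ⟨B, hB⟩ := exists_norm_picard_le hq hq0 a (dist x a)
  exact (Summable.of_norm_bounded (Real.summable_pow_div_factorial B)
    fun n => hB n x (Metric.mem_closedBall.2 le_rfl)).hasSum

theorem continuous_tsum_picard (hq : LocallyIntegrable q volume) (hq0 : ∀ᵐ x : ℝ, 0 ≤ q x)
    (a : ℝ) : Continuous fun x => ∑' n, picard q a n x := by
  refine continuous_iff_continuousAt.2 fun x => ?_
  obtain ⟨B, hB⟩ := exists_norm_picard_le hq hq0 a (dist x a + 1)
  exact (continuousOn_tsum (fun n => (continuous_picard hq a n).continuousOn)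
    (Real.summable_pow_div_factorial B) hB).continuousAt
    (mem_of_superset (Metric.isOpen_ball.mem_nhds (Metric.mem_ball.2 (lt_add_one _)))
      Metric.ball_subset_closedBall)

theorem tsum_picard_eq (hq : LocallyIntegrable q volume) (hq0 : ∀ᵐ x : ℝ, 0 ≤ q x) (a x : ℝ) :
    ∑' n, picard q a n x = 1 + ∫ t in a..x, (x - t) * (q t * ∑' n, picard q a n t) := by
  obtain ⟨B, hB⟩ := exists_norm_picard_le hq hq0 a (dist x a)
  have hball : ∀ t ∈ uIoc a x, t ∈ Metric.closedBall a (dist x a) := fun t ht => by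
    simpa [Real.dist_eq] using abs_sub_left_of_mem_uIcc (uIoc_subset_uIcc ht)
  have hint : ∀ w : ℝ → ℝ, Continuous w →
      IntervalIntegrable (fun t => (x - t) * (q t * w t)) volume a x := fun w hw =>
    locallyIntegrable_iff_intervalIntegrable.1 ((hq.mul_continuous hw).continuous_mul
      (continuous_const.sub continuous_id)) a x
  have hsum : HasSum (fun n => picard q a (n + 1) x)
      (∫ t in a..x, (x - t) * (q t * ∑' n, picard q a n t)) := by
    refine intervalIntegral.hasSum_integral_of_dominated_convergence
      (fun n t => |(x - t) * q t| * (B ^ n / n.factorial)) (fun n => ?_) (fun n => ?_) ?_ ?_ ?_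
    · exact (hint _ (continuous_picard hq a n)).def'.aestronglyMeasurable
    · refine Eventually.of_forall fun t ht => ?_
      rw [← mul_assoc, norm_mul, Real.norm_eq_abs]
      gcongr
      exact hB n t (hball t ht)
    · exact Eventually.of_forall fun t _ => (Real.summable_pow_div_factorial B).mul_left _
    · simp_rw [tsum_mul_left]
      exact ((by simpa using hint _ (continuous_const (y := 1)) :
        IntervalIntegrable (fun t => (x - t) * q t) volume a x).abs).mul_const _
    · refine Eventually.of_forall fun t _ => ?_
      simpa [mul_assoc] using (hasSum_picard hq hq0 a t).mul_left ((x - t) * q t)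
  rw [(hasSum_picard hq hq0 a x).summable.tsum_eq_zero_add, hsum.tsum_eq]
  rfl

theorem exists_isHomogeneousSolution (hq : LocallyIntegrable q volume)
    (hq0 : ∀ᵐ x : ℝ, 0 ≤ q x) (a : ℝ) :
    ∃ w w' : ℝ → ℝ, IsHomogeneousSolution q w w' ∧ w a = 1 ∧ w' a = 0 ∧ ∀ x, 1 ≤ w x := by
  set w : ℝ → ℝ := fun x => ∑' n, picard q a n x
  have hqw : LocallyIntegrable (fun t => q t * w t) volume :=
    hq.mul_continuous (continuous_tsum_picard hq hq0 a)
  have hw' := IsPrimitive.of_locallyIntegrable hqw a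
  have heq : w = fun x => 1 + ∫ t in a..x, (x - t) * (q t * w t) :=
    funext (tsum_picard_eq hq hq0 a)
  refine ⟨w, fun x => ∫ t in a..x, q t * w t, ⟨fun x => ?_, hw'⟩, ?_,
    intervalIntegral.integral_same, fun x => ?_⟩
  · nth_rewrite 1 [heq]
    exact ((isPrimitive_integral_sub_mul hqw a).hasDerivAt hw'.continuous x).const_add 1
  · rw [heq]; simp
  · exact (hasSum_picard hq hq0 a x).summable.le_tsum 0 fun n _ => picard_nonneg hq0 a n x

end Picard

/-! ### The length scale of a potential -/

section MonotoneDerivative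

variable {P Q : ℝ → ℝ} (hP : ∀ x, HasDerivAt P (Q x) x) (hQ : Monotone Q)
include hP hQ

theorem sub_mem_Icc_of_monotone_deriv {a b : ℝ} (hab : a ≤ b) :
    P b - P a ∈ Icc ((b - a) * Q a) ((b - a) * Q b) := by
  rcases hab.eq_or_lt with rfl | hlt
  · simp
  obtain ⟨c, ⟨hac, hcb⟩, hc⟩ := exists_hasDerivAt_eq_slope P Q hlt
    (fun x _ => (hP x).continuousAt.continuousWithinAt) fun x _ => hP x
  have hba : 0 < b - a := sub_pos.2 hlt
  rw [eq_div_iff hba.ne', mul_comm] at hc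
  rw [← hc]
  exact ⟨by gcongr; exact hQ hac.le, by gcongr; exact hQ hcb.le⟩

theorem increment_le_increment_of_monotone_deriv {h : ℝ} (hh : 0 ≤ h) {a b : ℝ} (hab : a ≤ b) :
    P (a + h) - P a ≤ P (b + h) - P b := by
  have hd : ∀ x, HasDerivAt (fun x => P (x + h) - P x) (Q (x + h) - Q x) x := fun x =>
    ((hP (x + h)).comp_add_const x h).sub (hP x)
  exact monotone_of_hasDerivAt_nonneg hd
    (fun x => sub_nonneg.2 (hQ (le_add_of_nonneg_right hh))) hab

end MonotoneDerivative

/-- An Otelbaev type length scale: the convex function `P`, with derivative `Q`, has second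
difference `2` at `x` for the step `s x`.  For `P'' = q` and `s = √2 d` this is the equation that
defines `d`. -/
structure IsOtelbaevScale (P Q s : ℝ → ℝ) : Prop where
  hasDerivAt : ∀ x, HasDerivAt P (Q x) x
  monotone : Monotone Q
  pos : ∀ x, 0 < s x
  eq_two : ∀ x, P (x + s x) + P (x - s x) - 2 * P x = 2

/-- The difference of the masses `Q (x + s x) - Q x` and `Q x - Q (x - s x)`, scaled by `s x`; it is
`√2 ν` for `Q' = q` and `s = √2 d`. -/
noncomputable def imbalance (Q s : ℝ → ℝ) (x : ℝ) : ℝ :=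
  s x * (Q (x + s x) - 2 * Q x + Q (x - s x))

/-- The derivative of an Otelbaev scale `s`, as given by implicit differentiation. -/
noncomputable def scaleSlope (Q s : ℝ → ℝ) (x : ℝ) : ℝ :=
  -imbalance Q s x / (s x * (Q (x + s x) - Q (x - s x)))

namespace IsOtelbaevScale

variable {P Q s : ℝ → ℝ}

theorem two_le_mul_sub_of_two_le (h : IsOtelbaevScale P Q s) {x σ : ℝ} (hσ : 0 ≤ σ)
    (h2 : 2 ≤ P (x + σ) + P (x - σ) - 2 * P x) : 2 ≤ σ * (Q (x + σ) - Q (x - σ)) := by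
  have hright := (sub_mem_Icc_of_monotone_deriv h.hasDerivAt h.monotone
    (by linarith : x ≤ x + σ)).2
  have hleft := (sub_mem_Icc_of_monotone_deriv h.hasDerivAt h.monotone
    (by linarith : x - σ ≤ x)).1
  linarith

theorem two_le_mul_sub (h : IsOtelbaevScale P Q s) (x : ℝ) :
    2 ≤ s x * (Q (x + s x) - Q (x - s x)) :=
  h.two_le_mul_sub_of_two_le (h.pos x).le (h.eq_two x).ge

theorem le_of_two_le (h : IsOtelbaevScale P Q s) {y σ : ℝ} (hσ : 0 < σ)
    (h2 : 2 ≤ P (y + σ) + P (y - σ) - 2 * P y) : s y ≤ σ := by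
  by_contra! hlt
  have hmass : 0 < Q (y + σ) - Q (y - σ) :=
    pos_of_mul_pos_right (two_pos.trans_le (h.two_le_mul_sub_of_two_le hσ.le h2)) hσ.le
  have hright := (sub_mem_Icc_of_monotone_deriv h.hasDerivAt h.monotone
    (by linarith : y + σ ≤ y + s y)).1
  have hleft := (sub_mem_Icc_of_monotone_deriv h.hasDerivAt h.monotone
    (by linarith : y - s y ≤ y - σ)).2
  linarith [h.eq_two y, mul_pos (sub_pos.2 hlt) hmass]

theorem le_add_abs_sub (h : IsOtelbaevScale P Q s) (x y : ℝ) : s y ≤ s x + |y - x| := by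
  have hs := h.pos x
  have heq := h.eq_two x
  have hinc : ∀ {k a b : ℝ}, 0 ≤ k → a ≤ b → P (a + k) - P a ≤ P (b + k) - P b :=
    fun hk hab => increment_le_increment_of_monotone_deriv h.hasDerivAt h.monotone hk hab
  refine h.le_of_two_le (by positivity) ?_
  rcases le_total x y with hxy | hxy
  · obtain ⟨k, hk, rfl⟩ : ∃ k, 0 ≤ k ∧ y = x + k := ⟨y - x, by linarith, by ring⟩
    have h₁ := hinc (by linarith : 0 ≤ 2 * k) (by linarith : x ≤ x + s x)
    have h₂ := hinc hk (by linarith : x ≤ x + k)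
    rw [add_sub_cancel_left, abs_of_nonneg hk]
    ring_nf at *
    linarith
  · obtain ⟨k, hk, rfl⟩ : ∃ k, 0 ≤ k ∧ y = x - k := ⟨x - y, by linarith, by ring⟩
    have h₁ := hinc (by linarith : 0 ≤ 2 * k) (by linarith : x - s x - 2 * k ≤ x - 2 * k)
    have h₂ := hinc hk (by linarith : x - 2 * k ≤ x - k)
    rw [sub_sub_cancel_left, abs_neg, abs_of_nonneg hk]
    ring_nf at *
    linarith

theorem lipschitzWith_one (h : IsOtelbaevScale P Q s) : LipschitzWith 1 s := by
  refine LipschitzWith.of_le_add fun x y => ?_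
  simpa [Real.dist_eq] using h.le_add_abs_sub y x

theorem hasDerivAt_scale (h : IsOtelbaevScale P Q s) (x : ℝ) :
    HasDerivAt s (scaleSlope Q s x) x := by
  have hs : Tendsto s (𝓝 x) (𝓝 (s x)) := h.lipschitzWith_one.continuous.continuousAt
  have hO : (fun y => s y - s x) =O[𝓝 x] fun y => y - x :=
    Asymptotics.IsBigO.of_bound 1 (Eventually.of_forall fun y => by
      simpa [Real.dist_eq] using h.lipschitzWith_one.dist_le_mul y x)
  have hid : (fun y : ℝ => y - x) =O[𝓝 x] fun y => y - x := Asymptotics.isBigO_refl _ _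
  have hright := ((hasDerivAt_iff_isLittleO.1 (h.hasDerivAt (x + s x))).comp_tendsto
    (tendsto_id.add hs)).trans_isBigO (k := fun y => y - x)
    ((hid.add hO).congr_left fun y => by simp only [Function.comp, id]; ring)
  have hleft := ((hasDerivAt_iff_isLittleO.1 (h.hasDerivAt (x - s x))).comp_tendsto
    (tendsto_id.sub hs)).trans_isBigO (k := fun y => y - x)
    ((hid.sub hO).congr_left fun y => by simp only [Function.comp, id]; ring)
  have hmid := (hasDerivAt_iff_isLittleO.1 (h.hasDerivAt x)).const_mul_left 2
  have hpos := h.pos x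
  have hmass : 0 < Q (x + s x) - Q (x - s x) :=
    pos_of_mul_pos_right (two_pos.trans_le (h.two_le_mul_sub x)) hpos.le
  refine hasDerivAt_iff_isLittleO.2 ((((hright.add hleft).sub hmid).const_mul_left
    (-(Q (x + s x) - Q (x - s x))⁻¹)).congr_left fun y => ?_)
  simp only [Function.comp, id, smul_eq_mul, scaleSlope, imbalance]
  field_simp
  linear_combination h.eq_two x - h.eq_two y

theorem abs_scaleSlope_le (h : IsOtelbaevScale P Q s) (x : ℝ) :
    |scaleSlope Q s x| ≤ |imbalance Q s x| / 2 := by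
  have hmass := h.two_le_mul_sub x
  rw [scaleSlope, abs_div, abs_neg, abs_of_pos (two_pos.trans_le hmass)]
  gcongr

theorem one_le_two_mul_mul_sub_left (h : IsOtelbaevScale P Q s) {x : ℝ}
    (hx : imbalance Q s x ≤ 1) : 1 ≤ 2 * s x * (Q x - Q (x - s x)) := by
  rw [imbalance] at hx
  linarith [h.two_le_mul_sub x]

theorem mul_sub_half_le (h : IsOtelbaevScale P Q s) (x : ℝ) :
    s x * (Q (x + s x / 2) - Q (x - s x / 2)) ≤ 4 := by
  have hs := h.pos x
  have hright := (sub_mem_Icc_of_monotone_deriv h.hasDerivAt h.monotone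
    (by linarith : x + s x / 2 ≤ x + s x)).1
  have hleft := (sub_mem_Icc_of_monotone_deriv h.hasDerivAt h.monotone
    (by linarith : x - s x ≤ x - s x / 2)).2
  have hmid := increment_le_increment_of_monotone_deriv h.hasDerivAt h.monotone
    (by linarith : 0 ≤ s x / 2) (by linarith : x - s x / 2 ≤ x)
  rw [sub_add_cancel] at hmid
  linarith [h.eq_two x]

end IsOtelbaevScale

section Standard

variable {q : ℝ → ℝ}

/-- The Otelbaev scale `√2 d` of the potential `q`. -/
noncomputable def otelbaevScale (q : ℝ → ℝ) (x : ℝ) : ℝ := Real.sqrt 2 * d q x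

theorem isOtelbaevScale (hq : LocallyIntegrable q volume) (hq0 : ∀ᵐ x : ℝ, 0 ≤ q x)
    (ht : PositiveTails q) :
    IsOtelbaevScale (fun x => ∫ r in (0 : ℝ)..x, ∫ t in (0 : ℝ)..r, q t)
      (fun x => ∫ t in (0 : ℝ)..x, q t) (otelbaevScale q) := by
  have hQ := IsPrimitive.of_locallyIntegrable hq 0
  set Q : ℝ → ℝ := fun x => ∫ t in (0 : ℝ)..x, q t
  have hP := IsPrimitive.of_locallyIntegrable hQ.continuous.locallyIntegrable 0
  refine ⟨hP.hasDerivAt hQ.continuous, hQ.monotone hq0,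
    fun x => mul_pos (by positivity) (d_spec hq hq0 ht x).1, fun x => ?_⟩
  have hF := (d_spec hq hq0 ht x).2.1
  simp_rw [F, hQ.integral_eq_sub] at hF
  rw [intervalIntegral.integral_sub, intervalIntegral.integral_comp_add_left,
    intervalIntegral.integral_comp_sub_left, hP.integral_eq_sub (x + 0),
    hP.integral_eq_sub (x - _), add_zero, sub_zero] at hF
  · rw [otelbaevScale]
    linarith
  · exact (hQ.continuous.comp (continuous_const.add continuous_id)).intervalIntegrable _ _
  · exact (hQ.continuous.comp (continuous_const.sub continuous_id)).intervalIntegrable _ _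

theorem imbalance_otelbaevScale (hq : LocallyIntegrable q volume) (x : ℝ) :
    imbalance (fun x => ∫ t in (0 : ℝ)..x, q t) (otelbaevScale q) x = Real.sqrt 2 * nu q x := by
  have hQ := IsPrimitive.of_locallyIntegrable hq 0
  have hright : IntervalIntegrable (fun t => q (x + t)) volume 0 (Real.sqrt 2 * d q x) := by
    simpa [add_comm] using
      (hQ.intervalIntegrable (0 + x) (Real.sqrt 2 * d q x + x)).comp_add_right x
  have hleft : IntervalIntegrable (fun t => q (x - t)) volume 0 (Real.sqrt 2 * d q x) := by
    simpa using (hQ.intervalIntegrable (x - 0) (x - Real.sqrt 2 * d q x)).comp_sub_left x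
  rw [nu, intervalIntegral.integral_sub hright hleft, intervalIntegral.integral_comp_add_left,
    intervalIntegral.integral_comp_sub_left, hQ.integral_eq_sub (x + 0),
    hQ.integral_eq_sub (x - _), imbalance, otelbaevScale, add_zero, sub_zero]
  ring

theorem qStar_eq_two_div_sq (q : ℝ → ℝ) : qStar q = fun x => 2 / otelbaevScale q x ^ 2 := by
  funext x
  rw [qStar, otelbaevScale, mul_pow, Real.sq_sqrt two_pos.le, ← div_div, div_self two_ne_zero]

end Standard

section Reflection

variable {q : ℝ → ℝ}

theorem d_comp_neg (q : ℝ → ℝ) (x : ℝ) : d (fun t => q (-t)) x = d q (-x) := by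
  have hF : ∀ η, F (fun t => q (-t)) x η = F q (-x) η := fun η =>
    intervalIntegral.integral_congr fun t _ => by
      simp only [intervalIntegral.integral_comp_neg]
      congr 1 <;> ring
  simp only [d, hF]

theorem otelbaevScale_comp_neg (q : ℝ → ℝ) (x : ℝ) :
    otelbaevScale (fun t => q (-t)) x = otelbaevScale q (-x) := by
  rw [otelbaevScale, otelbaevScale, d_comp_neg]

theorem nu_comp_neg (q : ℝ → ℝ) (x : ℝ) : nu (fun t => q (-t)) x = -nu q (-x) := by
  rw [nu, nu, d_comp_neg, ← mul_neg, ← intervalIntegral.integral_neg]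
  congr 1
  refine intervalIntegral.integral_congr fun t _ => ?_
  rw [neg_add', neg_sub, neg_sub, sub_eq_neg_add t x]

theorem InClassH.comp_neg (hH : InClassH q) : InClassH fun t => q (-t) := by
  have hneg : Tendsto (fun x : ℝ => -x) (atBot ⊔ atTop) (atBot ⊔ atTop) :=
    tendsto_sup.2 ⟨tendsto_neg_atBot_atTop.mono_right le_sup_right,
      tendsto_neg_atTop_atBot.mono_right le_sup_left⟩
  rw [InClassH, funext (nu_comp_neg q), ← neg_zero]
  exact (hH.comp hneg).neg

theorem PositiveTails.comp_neg (ht : PositiveTails q) : PositiveTails fun t => q (-t) := by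
  have hneg : ∀ s : Set ℝ, ∫⁻ t in Neg.neg ⁻¹' s, ENNReal.ofReal (q (-t)) =
      ∫⁻ t in s, ENNReal.ofReal (q t) := fun s =>
    (Measure.measurePreserving_neg volume).setLIntegral_comp_preimage_emb
      (Homeomorph.neg ℝ).measurableEmbedding (fun t => ENNReal.ofReal (q t)) s
  intro x
  constructor
  · simpa [← hneg (Ici (-x))] using (ht (-x)).2
  · simpa [← hneg (Iic (-x))] using (ht (-x)).1

end Reflection

/-! ### Localized solutions and non-admissibility -/

theorem isSolution_of_isPrimitive {q f y y' g : ℝ → ℝ} (hy : ∀ x, HasDerivAt y (y' x) x)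
    (hy' : IsPrimitive y' g) (heq : ∀ᵐ x : ℝ, -g x + q x * y x = f x) : IsSolution q f y := by
  have hderiv : deriv y = y' := funext fun x => (hy x).deriv
  refine ⟨fun x => (hy x).differentiableAt,
    (IsPrimitive.of_hasDerivAt hy hy'.continuous).absolutelyContinuousOnInterval, ?_, ?_⟩
  · exact hderiv ▸ hy'.absolutelyContinuousOnInterval
  · filter_upwards [heq, hy'.ae_hasDerivAt] with x hx hx'
    rw [hderiv, hx'.deriv, hx]

theorem isPrimitive_deriv_of_isSolution {q f y : ℝ → ℝ} (hy : IsSolution q f y) :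
    IsPrimitive (deriv y) fun x => q x * y x - f x :=
  (IsPrimitive.of_absolutelyContinuous hy.2.2.1).congr_ae
    (hy.2.2.2.mono fun x hx => by linarith)

/-- `φ`, with derivatives `φ'` and `φ''`, is a cutoff function equal to `1` on the ball of radius
`δ / 2` about `x₀` and to `0` off the ball of radius `δ`, with derivatives of the natural size
`C / δ` and `C / δ ^ 2`. -/
structure IsCutoff (x₀ δ C : ℝ) (φ φ' φ'' : ℝ → ℝ) : Prop where
  hasDerivAt : ∀ x, HasDerivAt φ (φ' x) x
  hasDerivAt' : ∀ x, HasDerivAt φ' (φ'' x) x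
  continuous : Continuous φ''
  eq_one : ∀ x, |x - x₀| ≤ δ / 2 → φ x = 1
  eq_zero : ∀ x, δ < |x - x₀| → φ x = 0 ∧ φ' x = 0 ∧ φ'' x = 0
  abs_deriv_le : ∀ x, |φ' x| ≤ C / δ
  abs_deriv_deriv_le : ∀ x, |φ'' x| ≤ C / δ ^ 2

theorem exists_isCutoff_zero_one :
    ∃ C : ℝ, 0 < C ∧ ∃ φ φ' φ'' : ℝ → ℝ, IsCutoff 0 1 C φ φ' φ'' := by
  let b : ContDiffBump (0 : ℝ) := ⟨1 / 2, 1, by norm_num, by norm_num⟩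
  have hb : ContDiff ℝ 2 b := b.contDiff
  have hb' : ContDiff ℝ 1 (deriv b) :=
    (contDiff_succ_iff_deriv.1 (by simpa [one_add_one_eq_two] using hb)).2.2
  have hb'' : Continuous (deriv (deriv b)) := hb'.continuous_deriv le_rfl
  have hsupp : HasCompactSupport b := b.hasCompactSupport
  obtain ⟨C₁, hC₁⟩ := hsupp.deriv.exists_bound_of_continuous hb'.continuous
  obtain ⟨C₂, hC₂⟩ := hsupp.deriv.deriv.exists_bound_of_continuous hb''
  refine ⟨max 1 (max C₁ C₂), by positivity, b, deriv b, deriv (deriv b),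
    ⟨fun x => (hb.differentiable (by norm_num) x).hasDerivAt,
      fun x => (hb'.differentiable (by norm_num) x).hasDerivAt, hb'',
      fun x hx => b.one_of_mem_closedBall (by simpa [b] using hx), fun x hx => ?_,
      fun x => (hC₁ x).trans (by simp), fun x => (hC₂ x).trans (by simp)⟩⟩
  have hx' : x ∉ tsupport b := by
    rw [b.tsupport_eq]
    simpa [b] using hx
  exact ⟨image_eq_zero_of_notMem_tsupport hx',
    image_eq_zero_of_notMem_tsupport fun h => hx' (tsupport_deriv_subset h),
    image_eq_zero_of_notMem_tsupport
      fun h => hx' (tsupport_deriv_subset (tsupport_deriv_subset h))⟩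

theorem IsCutoff.rescale {C : ℝ} {φ φ' φ'' : ℝ → ℝ} (hφ : IsCutoff 0 1 C φ φ' φ'')
    (x₀ : ℝ) {δ : ℝ} (hδ : 0 < δ) :
    IsCutoff x₀ δ C (fun x => φ ((x - x₀) / δ)) (fun x => φ' ((x - x₀) / δ) / δ)
      (fun x => φ'' ((x - x₀) / δ) / δ ^ 2) where
  hasDerivAt x := by
    simpa [Function.comp_def, div_eq_mul_inv] using (hφ.hasDerivAt ((x - x₀) / δ)).comp x
      (((hasDerivAt_id x).sub_const x₀).div_const δ)
  hasDerivAt' x := by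
    simpa [Function.comp_def, div_eq_mul_inv, pow_two, mul_assoc] using
      ((hφ.hasDerivAt' ((x - x₀) / δ)).comp x
        (((hasDerivAt_id x).sub_const x₀).div_const δ)).div_const δ
  continuous := (hφ.continuous.comp (by fun_prop)).div_const _
  eq_one x hx := hφ.eq_one _ <| by
    rw [sub_zero, abs_div, abs_of_pos hδ, div_le_iff₀ hδ]
    linarith
  eq_zero x hx := by
    obtain ⟨h, h', h''⟩ := hφ.eq_zero ((x - x₀) / δ) <| by
      rwa [sub_zero, abs_div, abs_of_pos hδ, one_lt_div hδ]
    simp [h, h', h'']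
  abs_deriv_le x := by
    rw [abs_div, abs_of_pos hδ]
    gcongr
    simpa using hφ.abs_deriv_le ((x - x₀) / δ)
  abs_deriv_deriv_le x := by
    rw [abs_div, abs_of_pos (pow_pos hδ 2)]
    gcongr
    simpa using hφ.abs_deriv_deriv_le ((x - x₀) / δ)

/- Convexity gives `w x - 1 ≤ (x - x₀) * w' x`, while `w' x ≤ w x * ∫ q`. -/
theorem IsHomogeneousSolution.bounds_of_le {q w w' : ℝ → ℝ} (hw : IsHomogeneousSolution q w w')
    (hq : LocallyIntegrable q volume) (hq0 : ∀ᵐ x : ℝ, 0 ≤ q x) (hw1 : ∀ x, 1 ≤ w x) {x₀ x : ℝ}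
    (hwx₀ : w x₀ = 1) (hwx₀' : w' x₀ = 0) (hx : x₀ ≤ x)
    (hmass : (x - x₀) * ∫ t in x₀..x, q t ≤ 1 / 2) :
    w x ≤ 2 ∧ 0 ≤ w' x ∧ w' x ≤ 2 * ∫ t in x₀..x, q t := by
  have hmono : Monotone w' := hw.monotone_deriv hq0 fun t => zero_le_one.trans (hw1 t)
  have hw'0 : ∀ {t}, x₀ ≤ t → 0 ≤ w' t := fun ht => hwx₀' ▸ hmono ht
  have hq' := locallyIntegrable_iff_intervalIntegrable.1 hq x₀ x
  have hm0 : 0 ≤ ∫ t in x₀..x, q t := intervalIntegral.integral_nonneg_of_ae hx hq0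
  have hderiv : w' x ≤ w x * ∫ t in x₀..x, q t := by
    rw [hw.isPrimitive_deriv.eq_add_integral x₀ x, hwx₀', zero_add,
      ← intervalIntegral.integral_const_mul]
    refine intervalIntegral.integral_mono_ae_restrict hx
      (hw.isPrimitive_deriv.intervalIntegrable _ _) (hq'.const_mul _) ?_
    filter_upwards [ae_restrict_of_ae hq0, ae_restrict_mem measurableSet_Icc] with t hqt ht
    have hwt : w t ≤ w x := by
      have := (sub_mem_Icc_of_monotone_deriv hw.hasDerivAt hmono ht.2).1
      nlinarith [hw'0 ht.1, ht.2]
    rw [mul_comm (w x)]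
    exact mul_le_mul_of_nonneg_left hwt hqt
  have htangent := (sub_mem_Icc_of_monotone_deriv hw.hasDerivAt hmono hx).2
  have hwx : w x ≤ 2 := by nlinarith [hw1 x]
  exact ⟨hwx, hw'0 hx, hderiv.trans (by gcongr)⟩

theorem IsHomogeneousSolution.bounds_of_abs_le {q w w' : ℝ → ℝ}
    (hw : IsHomogeneousSolution q w w') (hq : LocallyIntegrable q volume)
    (hq0 : ∀ᵐ x : ℝ, 0 ≤ q x) (hw1 : ∀ x, 1 ≤ w x) {x₀ δ : ℝ} (hδ : 0 < δ) (hwx₀ : w x₀ = 1)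
    (hwx₀' : w' x₀ = 0) (hmass : δ * ∫ t in (x₀ - δ)..(x₀ + δ), q t ≤ 1 / 2) {x : ℝ}
    (hx : |x - x₀| ≤ δ) : w x ≤ 2 ∧ |w' x| ≤ 1 / δ := by
  have hQ := IsPrimitive.of_locallyIntegrable hq 0
  have hsub : ∀ {a b}, x₀ - δ ≤ a → a ≤ b → b ≤ x₀ + δ → b - a ≤ δ →
      (b - a) * ∫ t in a..b, q t ≤ 1 / 2 ∧ 2 * ∫ t in a..b, q t ≤ 1 / δ := by
    intro a b ha hab hb hba
    have hle : ∫ t in a..b, q t ≤ ∫ t in (x₀ - δ)..(x₀ + δ), q t := by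
      rw [hQ.integral_eq_sub a b, hQ.integral_eq_sub (x₀ - δ)]
      exact sub_le_sub (hQ.monotone hq0 hb) (hQ.monotone hq0 ha)
    have h0 : 0 ≤ ∫ t in a..b, q t := intervalIntegral.integral_nonneg_of_ae hab hq0
    rw [le_div_iff₀ hδ]
    constructor <;> nlinarith
  obtain ⟨hlow, hupp⟩ := abs_le.1 hx
  rcases le_total x₀ x with h | h
  · obtain ⟨hm, hm'⟩ := hsub (a := x₀) (b := x) (by linarith) h (by linarith) (by linarith)
    obtain ⟨h2, h0, hd⟩ := hw.bounds_of_le hq hq0 hw1 hwx₀ hwx₀' h hm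
    exact ⟨h2, by rw [abs_of_nonneg h0]; exact hd.trans hm'⟩
  · obtain ⟨hm, hm'⟩ := hsub (a := x) (b := x₀) (by linarith) h (by linarith) (by linarith)
    have hrefl : ∫ t in (-x₀)..(-x), q (-t) = ∫ t in x..x₀, q t := by
      rw [intervalIntegral.integral_comp_neg, neg_neg, neg_neg]
    obtain ⟨h2, h0, hd⟩ := hw.comp_neg.bounds_of_le (x₀ := -x₀) (x := -x)
      (locallyIntegrable_comp_neg hq) (ae_nonneg_comp_neg hq0) (fun t => hw1 _) (by simpa)
      (by simpa) (by linarith) (by rw [hrefl]; linarith)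
    rw [hrefl, neg_neg] at hd
    simp only [neg_neg] at h2 h0
    exact ⟨h2, by rw [abs_of_nonpos (by linarith)]; exact hd.trans hm'⟩

theorem IsCutoff.isSolution_mul {q w w' : ℝ → ℝ} {x₀ δ C : ℝ} {φ φ' φ'' : ℝ → ℝ}
    (hφ : IsCutoff x₀ δ C φ φ' φ'') (hw : IsHomogeneousSolution q w w') :
    IsSolution q (fun x => -(φ'' x * w x + 2 * (φ' x * w' x))) fun x => φ x * w x := by
  have hφ'' := IsPrimitive.of_hasDerivAt hφ.hasDerivAt' hφ.continuous
  have hφ' := IsPrimitive.of_hasDerivAt hφ.hasDerivAt hφ''.continuous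
  exact isSolution_of_isPrimitive (fun x => (hφ.hasDerivAt x).mul (hw.hasDerivAt x))
    ((hφ''.mul hw.isPrimitive).add (hφ'.mul hw.isPrimitive_deriv))
    (Eventually.of_forall fun x => by ring)

theorem exists_localized_solution {q : ℝ → ℝ} (hq : LocallyIntegrable q volume)
    (hq0 : ∀ᵐ x : ℝ, 0 ≤ q x) :
    ∃ C : ℝ, 0 < C ∧ ∀ x₀ δ : ℝ, 0 < δ → δ * ∫ t in (x₀ - δ)..(x₀ + δ), q t ≤ 1 / 2 →
      ∃ y f : ℝ → ℝ, IsSolution q f y ∧ Continuous y ∧ Continuous f ∧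
        (Function.support y ⊆ Metric.closedBall x₀ δ) ∧
        (Function.support f ⊆ Metric.closedBall x₀ δ) ∧
        (∀ x ∈ Metric.closedBall x₀ (δ / 2), 1 ≤ y x) ∧ ∀ x, |f x| ≤ C / δ ^ 2 := by
  obtain ⟨C, hC, φ, φ', φ'', hφ₁⟩ := exists_isCutoff_zero_one
  refine ⟨4 * C, by positivity, fun x₀ δ hδ hmass => ?_⟩
  obtain ⟨w, w', hw, hwx₀, hwx₀', hw1⟩ := exists_isHomogeneousSolution hq hq0 x₀
  have hφ := hφ₁.rescale x₀ hδ
  set φ := fun x => φ ((x - x₀) / δ)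
  set φ' := fun x => φ' ((x - x₀) / δ) / δ
  set φ'' := fun x => φ'' ((x - x₀) / δ) / δ ^ 2
  have hwc := hw.continuous
  have hwc' := hw.isPrimitive_deriv.continuous
  have hφc'' := hφ.continuous
  have hφc' : Continuous φ' :=
    continuous_iff_continuousAt.2 fun x => (hφ.hasDerivAt' x).continuousAt
  have hφc : Continuous φ := continuous_iff_continuousAt.2 fun x => (hφ.hasDerivAt x).continuousAt
  have hvanish : ∀ {x}, x ∉ Metric.closedBall x₀ δ → φ x = 0 ∧ φ' x = 0 ∧ φ'' x = 0 :=
    fun hx => hφ.eq_zero _ (by simpa [Real.dist_eq] using hx)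
  refine ⟨_, _, hφ.isSolution_mul hw, by fun_prop, by fun_prop, ?_, ?_, fun x hx => ?_,
    fun x => ?_⟩
  · exact Function.support_subset_iff'.2 fun x hx => by simp [(hvanish hx).1]
  · exact Function.support_subset_iff'.2 fun x hx => by simp [(hvanish hx).2]
  · rw [hφ.eq_one x (by simpa [Real.dist_eq] using hx), one_mul]
    exact hw1 x
  · by_cases hx : |x - x₀| ≤ δ
    · obtain ⟨hw2, hw2'⟩ := hw.bounds_of_abs_le hq hq0 hw1 hδ hwx₀ hwx₀' hmass hx
      have hw2 : |w x| ≤ 2 := by rwa [abs_of_nonneg (zero_le_one.trans (hw1 x))]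
      calc |-(φ'' x * w x + 2 * (φ' x * w' x))|
          ≤ |φ'' x| * |w x| + 2 * (|φ' x| * |w' x|) := by
            rw [abs_neg]
            refine (abs_add_le _ _).trans (by simp [abs_mul])
        _ ≤ C / δ ^ 2 * 2 + 2 * (C / δ * (1 / δ)) := by
            gcongr
            exacts [hφ.abs_deriv_deriv_le x, hφ.abs_deriv_le x]
        _ = 4 * C / δ ^ 2 := by field_simp; ring
    · obtain ⟨-, h', h''⟩ := hφ.eq_zero x (not_le.1 hx)
      rw [h', h'']
      simp only [zero_mul, mul_zero, add_zero, neg_zero, abs_zero]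
      positivity

section LpNorm

variable {α E : Type*} [MeasurableSpace α] {μ : Measure α} [NormedAddCommGroup E] {f : α → E}
  {s : Set α} {c : ℝ}

theorem ofReal_mul_measure_rpow_le_eLpNorm {p : ℝ≥0∞} (hp : p ≠ 0) (hs : MeasurableSet s)
    (hμs : μ s ≠ 0) (hc : 0 ≤ c) (hf : ∀ x ∈ s, c ≤ ‖f x‖) :
    ENNReal.ofReal c * μ s ^ (1 / p.toReal) ≤ eLpNorm f p μ := by
  rw [← Real.enorm_of_nonneg hc, ← eLpNorm_indicator_const' hs hμs hp]
  refine eLpNorm_mono fun x => ?_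
  by_cases hx : x ∈ s
  · simpa [hx, abs_of_nonneg hc] using hf x hx
  · simp [hx]

theorem eLpNorm_le_ofReal_mul_measure_rpow (p : ℝ≥0∞) (hc : 0 ≤ c)
    (hsupp : Function.support f ⊆ s) (hf : ∀ x, ‖f x‖ ≤ c) :
    eLpNorm f p μ ≤ ENNReal.ofReal c * μ s ^ (1 / p.toReal) := by
  refine (eLpNorm_mono_real (g := s.indicator fun _ => c) fun x => ?_).trans
    ((eLpNorm_indicator_const_le c p).trans_eq (by rw [Real.enorm_of_nonneg hc]))
  by_cases hx : x ∈ s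
  · simpa [hx] using hf x
  · simp [hx, Function.notMem_support.1 fun h => hx (hsupp h)]

end LpNorm

theorem memWeightedLp_one_of_hasCompactSupport {g : ℝ → ℝ} (hg : Continuous g)
    (hsupp : HasCompactSupport g) (p : ℝ≥0∞) : MemWeightedLp p (fun _ => 1) g :=
  have hmem : MemLp g p volume := hg.memLp_of_hasCompactSupport hsupp
  ⟨fun K _ => hmem.restrict K, by simpa using hmem⟩

theorem exists_sq_le_of_admissible {q : ℝ → ℝ} (hq : LocallyIntegrable q volume)
    (hq0 : ∀ᵐ x : ℝ, 0 ≤ q x) {p : ℝ≥0∞} (hp : p ≠ 0)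
    (hadm : Admissible q p (fun _ => 1) (fun _ => 1)) :
    ∃ B : ℝ, ∀ x₀ δ : ℝ, 0 < δ → δ * ∫ t in (x₀ - δ)..(x₀ + δ), q t ≤ 1 / 2 → δ ^ 2 ≤ B := by
  obtain ⟨C, hC, hlocal⟩ := exists_localized_solution hq hq0
  obtain ⟨-, -, -, c, hc, hbound⟩ := hadm
  refine ⟨c * C * 2 ^ (1 / p.toReal), fun x₀ δ hδ hmass => ?_⟩
  obtain ⟨y, f, hsol, hyc, hfc, hys, hfs, hy1, hfC⟩ := hlocal x₀ δ hδ hmass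
  have hball : IsCompact (Metric.closedBall x₀ δ) := isCompact_closedBall x₀ δ
  have hnorm := hbound f y
    (memWeightedLp_one_of_hasCompactSupport hfc (.of_support_subset_isCompact hball hfs) p) hsol
    (memWeightedLp_one_of_hasCompactSupport hyc (.of_support_subset_isCompact hball hys) p)
  simp only [weightedNorm, one_mul] at hnorm
  have hlower := ofReal_mul_measure_rpow_le_eLpNorm (μ := volume) (c := 1) hp
    (Metric.isClosed_closedBall (x := x₀) (ε := δ / 2)).measurableSet (by simp [hδ]) zero_le_one
    fun x hx => (hy1 x hx).trans (Real.le_norm_self _)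
  have hupper := eLpNorm_le_ofReal_mul_measure_rpow (μ := volume) p (by positivity) hfs hfC
  have hchain := hlower.trans (hnorm.trans (mul_le_mul_right hupper _))
  rw [Real.volume_closedBall, Real.volume_closedBall, mul_div_cancel₀ _ two_ne_zero,
    ENNReal.ofReal_rpow_of_pos hδ, ENNReal.ofReal_rpow_of_pos (by positivity),
    ← ENNReal.ofReal_mul zero_le_one, ← ENNReal.ofReal_mul (by positivity),
    ← ENNReal.ofReal_mul hc.le, ENNReal.ofReal_le_ofReal_iff (by positivity), one_mul,
    Real.mul_rpow two_pos.le hδ.le] at hchain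
  have hδp : 0 < δ ^ (1 / p.toReal) := by positivity
  have hone : 1 ≤ c * C * 2 ^ (1 / p.toReal) / δ ^ 2 := by
    refine le_of_mul_le_mul_right (a := δ ^ (1 / p.toReal)) ?_ hδp
    calc 1 * δ ^ (1 / p.toReal) = δ ^ (1 / p.toReal) := one_mul _
      _ ≤ _ := hchain
      _ = c * C * 2 ^ (1 / p.toReal) / δ ^ 2 * δ ^ (1 / p.toReal) := by ring
  rwa [one_le_div (by positivity)] at hone

theorem not_admissible_one {q : ℝ → ℝ} (hq : LocallyIntegrable q volume)
    (hq0 : ∀ᵐ x : ℝ, 0 ≤ q x) (ht : PositiveTails q) (hd : ∀ M : ℝ, ∃ x : ℝ, M < d q x)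
    {p : ℝ≥0∞} (hp : p ≠ 0) : ¬ Admissible q p (fun _ => 1) (fun _ => 1) := by
  intro hadm
  obtain ⟨B, hB⟩ := exists_sq_le_of_admissible hq hq0 hp hadm
  obtain ⟨x₀, hx₀⟩ := hd (32 * (B + 1))
  have hs := isOtelbaevScale hq hq0 ht
  have hQ := IsPrimitive.of_locallyIntegrable hq 0
  set δ := otelbaevScale q x₀ / 8 with hδ
  have hscale : otelbaevScale q x₀ = 8 * δ := by rw [hδ]; ring
  have hδ0 : 0 < δ := by linarith [hs.pos x₀]
  have hsq : 32 * δ ^ 2 = d q x₀ ^ 2 := by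
    rw [hδ, otelbaevScale, div_pow, mul_pow, Real.sq_sqrt two_pos.le]; ring
  have hmass : δ * ∫ t in (x₀ - δ)..(x₀ + δ), q t ≤ 1 / 2 := by
    have hmul := hs.mul_sub_half_le x₀
    rw [hscale] at hmul
    have hlow := hQ.monotone hq0 (by linarith : x₀ - 8 * δ / 2 ≤ x₀ - δ)
    have hupp := hQ.monotone hq0 (by linarith : x₀ + δ ≤ x₀ + 8 * δ / 2)
    rw [hQ.integral_eq_sub]
    nlinarith
  nlinarith [hB x₀ δ hδ0 hmass, sq_nonneg δ]

/-! ### The principal solution -/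

theorem integral_Iic_le_of_intervalIntegral_le {g : ℝ → ℝ} {x B : ℝ}
    (hg : LocallyIntegrable g volume) (hg0 : ∀ᵐ t : ℝ, 0 ≤ g t)
    (hB : ∀ a ≤ x, ∫ t in a..x, g t ≤ B) : IntegrableOn g (Iic x) ∧ ∫ t in Iic x, g t ≤ B := by
  have hint : IntegrableOn g (Iic x) := by
    refine integrableOn_Iic_of_intervalIntegral_norm_bounded (l := atBot) (a := id) B x
      (fun a => (hg.integrableOn_isCompact isCompact_Icc).mono_set Ioc_subset_Icc_self)
      tendsto_id ?_
    filter_upwards [eventually_le_atBot x] with a ha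
    refine (intervalIntegral.integral_congr_ae ?_).trans_le (hB a ha)
    exact hg0.mono fun t ht _ => Real.norm_of_nonneg ht
  refine ⟨hint, le_of_tendsto (intervalIntegral_tendsto_integral_Iic x hint tendsto_id) ?_⟩
  filter_upwards [eventually_le_atBot x] with a ha using hB a ha

theorem lintegral_Iic_le_of_intervalIntegral_le {g : ℝ → ℝ} {x B : ℝ}
    (hg : LocallyIntegrable g volume) (hg0 : ∀ᵐ t : ℝ, 0 ≤ g t)
    (hB : ∀ a ≤ x, ∫ t in a..x, g t ≤ B) :
    ∫⁻ t in Iic x, ENNReal.ofReal (g t) ≤ ENNReal.ofReal B := by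
  obtain ⟨hint, hle⟩ := integral_Iic_le_of_intervalIntegral_le hg hg0 hB
  rw [← ofReal_integral_eq_lintegral_ofReal hint (ae_restrict_of_ae hg0)]
  exact ENNReal.ofReal_le_ofReal hle

theorem intervalIntegral_le_of_le_deriv {g h h' : ℝ → ℝ} {a x : ℝ} (hax : a ≤ x)
    (hg : LocallyIntegrable g volume) (hh : ∀ t, HasDerivAt h (h' t) t) (hh0 : ∀ t, 0 ≤ h t)
    (hgh : ∀ t ≤ x, g t ≤ h' t) : ∫ t in a..x, g t ≤ h x := by
  have := intervalIntegral.integral_le_sub_of_hasDeriv_right_of_le hax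
    (fun t _ => (hh t).continuousAt.continuousWithinAt) (fun t _ => (hh t).hasDerivWithinAt)
    (hg.integrableOn_isCompact isCompact_Icc) (fun t ht => hgh t ht.2.le)
  linarith [hh0 a]

theorem IsPrimitive.setIntegral_Iic {g : ℝ → ℝ} (hg : ∀ x, IntegrableOn g (Iic x)) :
    IsPrimitive (fun x => ∫ t in Iic x, g t) g where
  locallyIntegrable := locallyIntegrable_iff_intervalIntegrable.2 fun a b =>
    intervalIntegrable_iff.2 <| (hg (max a b)).mono_set fun _ ht => ht.2
  integral_eq_sub a b := (intervalIntegral.integral_Iic_sub_Iic (hg a) (hg b)).symm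

theorem exists_intervalIntegral_pos {q : ℝ → ℝ} (hq : LocallyIntegrable q volume)
    (hq0 : ∀ᵐ x : ℝ, 0 ≤ q x) (ht : PositiveTails q) (x : ℝ) :
    ∃ a < x, 0 < ∫ t in a..x, q t := by
  by_contra! hle
  have hzero := lintegral_Iic_le_of_intervalIntegral_le (x := x) (B := 0) hq hq0 fun a ha => by
    rcases ha.eq_or_lt with rfl | ha
    · simp
    · exact hle a ha
  exact (ht x).1.ne' (by simpa using hzero)

namespace IsHomogeneousSolution

variable {q u u' z z' : ℝ → ℝ}

theorem mul_integral_le_sub (hu : IsHomogeneousSolution q u u') (hq : LocallyIntegrable q volume)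
    (hq0 : ∀ᵐ x : ℝ, 0 ≤ q x) {a b m : ℝ} (hab : a ≤ b) (hm : ∀ t ∈ Icc a b, m ≤ u t) :
    m * ∫ t in a..b, q t ≤ u' b - u' a := by
  rw [← hu.isPrimitive_deriv.integral_eq_sub, ← intervalIntegral.integral_const_mul]
  refine intervalIntegral.integral_mono_ae_restrict hab
    ((locallyIntegrable_iff_intervalIntegrable.1 hq a b).const_mul m)
    (hu.isPrimitive_deriv.intervalIntegrable a b) ?_
  filter_upwards [ae_restrict_of_ae hq0, ae_restrict_mem measurableSet_Icc] with t hqt ht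
  rw [mul_comm m]
  exact mul_le_mul_of_nonneg_left (hm t ht) hqt

theorem monotone (hu : IsHomogeneousSolution q u u') (hu' : ∀ x, 0 ≤ u' x) : Monotone u :=
  monotone_of_hasDerivAt_nonneg hu.hasDerivAt hu'

theorem deriv_pos (hu : IsHomogeneousSolution q u u') (hq : LocallyIntegrable q volume)
    (hq0 : ∀ᵐ x : ℝ, 0 ≤ q x) (hmass : ∀ x, ∃ a < x, 0 < ∫ t in a..x, q t)
    (hpos : ∀ x, 0 < u x) (hu' : ∀ x, 0 ≤ u' x) (x : ℝ) : 0 < u' x := by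
  obtain ⟨a, hax, hm⟩ := hmass x
  have hgrow := hu.mul_integral_le_sub hq hq0 hax.le fun t ht => hu.monotone hu' ht.1
  linarith [mul_pos (hpos a) hm, hu' a]

theorem continuous_one_div_sq (hz : IsHomogeneousSolution q z z') (hz0 : ∀ x, 0 < z x) :
    Continuous fun t => 1 / z t ^ 2 :=
  continuous_const.div (hz.continuous.pow 2) fun x => (pow_pos (hz0 x) 2).ne'

theorem hasDerivAt_one_div (hz : IsHomogeneousSolution q z z') (hz0 : ∀ x, 0 < z x) (t : ℝ) :
    HasDerivAt (fun t => 1 / z t) (-z' t / z t ^ 2) t := by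
  simpa only [one_div] using! (hz.hasDerivAt t).inv (hz0 t).ne'

theorem reduction_of_order {A : ℝ → ℝ} (hz : IsHomogeneousSolution q z z') (hz0 : ∀ x, 0 < z x)
    (hA : IsPrimitive A fun t => 1 / z t ^ 2) :
    IsHomogeneousSolution q (fun x => z x * A x) fun x => z' x * A x + 1 / z x where
  hasDerivAt x := by
    refine ((hz.hasDerivAt x).mul
      (hA.hasDerivAt (hz.continuous_one_div_sq hz0) x)).congr_deriv ?_
    have := (hz0 x).ne'
    field_simp
  isPrimitive_deriv := by
    have hinv := IsPrimitive.of_hasDerivAt (hz.hasDerivAt_one_div hz0)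
      (hz.isPrimitive_deriv.continuous.neg.div (hz.continuous.pow 2)
        fun x => (pow_pos (hz0 x) 2).ne')
    refine ((hz.isPrimitive_deriv.mul hA).add hinv).congr_ae (Eventually.of_forall fun x => ?_)
    have := (hz0 x).ne'
    field_simp
    ring

/- `1 / z` has derivative `-z' / z ^ 2 ≥ -z' x / z ^ 2` to the left of `x`. -/
theorem integral_one_div_sq_le (hz : IsHomogeneousSolution q z z') (hq0 : ∀ᵐ x : ℝ, 0 ≤ q x)
    (hz0 : ∀ x, 0 < z x) {x : ℝ} (hx : z' x < 0) :
    IntegrableOn (fun t => 1 / z t ^ 2) (Iic x) ∧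
      -z' x * ∫ t in Iic x, 1 / z t ^ 2 ≤ 1 / z x := by
  have hx' : 0 < -z' x := neg_pos.2 hx
  have hmono := hz.monotone_deriv hq0 fun t => (hz0 t).le
  have hcont := (hz.continuous_one_div_sq hz0).locallyIntegrable (μ := volume)
  obtain ⟨hint, hle⟩ := integral_Iic_le_of_intervalIntegral_le (x := x)
    (B := (-z' x)⁻¹ * (1 / z x)) hcont (Eventually.of_forall fun t => by positivity) fun a ha =>
      intervalIntegral_le_of_le_deriv ha hcont
        (fun t => (hz.hasDerivAt_one_div hz0 t).const_mul (-z' x)⁻¹)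
        (fun t => mul_nonneg (inv_nonneg.2 hx'.le) (one_div_pos.2 (hz0 t)).le) fun t ht => by
          rw [mul_div_assoc', ← div_eq_inv_mul]
          gcongr
          rw [one_le_div hx']
          exact neg_le_neg (hmono ht)
  exact ⟨hint, by rwa [← le_inv_mul_iff₀ hx']⟩

theorem integrableOn_one_div_sq (hz : IsHomogeneousSolution q z z') (hq0 : ∀ᵐ x : ℝ, 0 ≤ q x)
    (hz0 : ∀ x, 0 < z x) {x₁ : ℝ} (hx₁ : z' x₁ < 0) (x : ℝ) :
    IntegrableOn (fun t => 1 / z t ^ 2) (Iic x) :=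
  ((hz.integral_one_div_sq_le hq0 hz0 hx₁).1.union
    (hz.continuous_one_div_sq hz0).integrableOn_Icc).mono_set fun t ht =>
      (le_total t x₁).imp id fun h => ⟨h, ht⟩

theorem le_three_mul (hu : IsHomogeneousSolution q u u') (hq : LocallyIntegrable q volume)
    (hq0 : ∀ᵐ x : ℝ, 0 ≤ q x) (hu0 : ∀ x, 0 ≤ u x) (hu'0 : ∀ x, 0 ≤ u' x) {x s : ℝ}
    (hs : 0 ≤ s) (hmass : 1 ≤ 2 * s * ∫ t in (x - s)..x, q t) : u x ≤ 3 * (s * u' x) := by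
  have hxs : x - s ≤ x := by linarith
  have htangent := (sub_mem_Icc_of_monotone_deriv hu.hasDerivAt (hu.monotone_deriv hq0 hu0) hxs).2
  have hgrow := hu.mul_integral_le_sub hq hq0 hxs fun t ht => hu.monotone hu'0 ht.1
  have hleft := mul_le_mul_of_nonneg_left hmass (hu0 (x - s))
  nlinarith [hu'0 (x - s)]

end IsHomogeneousSolution

/- The principal solution at `-∞` is `z x * ∫_{-∞}^x z⁻²` for a solution `z ≥ 1` whose derivative
is eventually negative at `-∞`. -/
theorem exists_isHomogeneousSolution_pos_deriv_pos {q : ℝ → ℝ} (hq : LocallyIntegrable q volume)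
    (hq0 : ∀ᵐ x : ℝ, 0 ≤ q x) (hmass : ∀ x, ∃ a < x, 0 < ∫ t in a..x, q t) :
    ∃ u u' : ℝ → ℝ, IsHomogeneousSolution q u u' ∧ (∀ x, 0 < u x) ∧ ∀ x, 0 < u' x := by
  obtain ⟨z, z', hz, -, hz'0, hz1⟩ := exists_isHomogeneousSolution hq hq0 0
  have hz0 : ∀ x, 0 < z x := fun x => zero_lt_one.trans_le (hz1 x)
  obtain ⟨x₁, hx₁, hm⟩ := hmass 0
  have hx₁' : z' x₁ < 0 := by
    have := hz.mul_integral_le_sub hq hq0 hx₁.le fun t _ => hz1 t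
    linarith
  set A : ℝ → ℝ := fun x => ∫ t in Iic x, 1 / z t ^ 2
  have hA : IsPrimitive A fun t => 1 / z t ^ 2 :=
    .setIntegral_Iic (hz.integrableOn_one_div_sq hq0 hz0 hx₁')
  have hA0 : ∀ x, 0 < A x := fun x => by
    have hnonneg : 0 ≤ A (x - 1) := setIntegral_nonneg measurableSet_Iic fun t _ => by positivity
    have hpos : 0 < ∫ t in (x - 1)..x, 1 / z t ^ 2 :=
      intervalIntegral.intervalIntegral_pos_of_pos (hA.intervalIntegrable _ _)
        (fun t => one_div_pos.2 (pow_pos (hz0 t) 2)) (by linarith)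
    rw [hA.integral_eq_sub] at hpos
    linarith
  have hu := hz.reduction_of_order hz0 hA
  have hu0 : ∀ x, 0 < z x * A x := fun x => mul_pos (hz0 x) (hA0 x)
  have hderiv : ∀ x, 0 ≤ z' x * A x + 1 / z x := fun x => by
    rcases lt_or_ge (z' x) 0 with hx | hx
    · linarith [(hz.integral_one_div_sq_le hq0 hz0 hx).2]
    · have := hA0 x
      have := hz0 x
      positivity
  exact ⟨_, _, hu, hu0, hu.deriv_pos hq hq0 hmass hu0 hderiv⟩

/-! ### Growth on a slowly varying scale -/

/-- `s` is a slowly varying length scale with derivative `s'`: positive, with slope at most `1` and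
tending to `0` at infinity. -/
structure IsSlowScale (s s' : ℝ → ℝ) : Prop where
  hasDerivAt : ∀ x, HasDerivAt s (s' x) x
  pos : ∀ x, 0 < s x
  abs_deriv_le_one : ∀ x, |s' x| ≤ 1
  tendsto_deriv : Tendsto s' (cocompact ℝ) (𝓝 0)

theorem exists_pos_forall_le_of_eventually_cocompact {X : Type*} [TopologicalSpace X] {g : X → ℝ}
    {c : ℝ} (hg : Continuous g) (hg0 : ∀ x, 0 < g x) (hc : 0 < c)
    (hev : ∀ᶠ x in cocompact X, c ≤ g x) : ∃ m : ℝ, 0 < m ∧ ∀ x, m ≤ g x := by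
  obtain ⟨K, hK, hKc⟩ := mem_cocompact.1 hev
  obtain ⟨m, hm, hmK⟩ := hK.exists_forall_le' hg.continuousOn fun x _ => hg0 x
  refine ⟨min m c, lt_min hm hc, fun x => ?_⟩
  by_cases hx : x ∈ K
  · exact (min_le_left _ _).trans (hmK x hx)
  · exact (min_le_right _ _).trans (hKc hx)

namespace IsSlowScale

variable {s s' u u' : ℝ → ℝ} {κ : ℝ}

theorem continuous (hs : IsSlowScale s s') : Continuous s :=
  continuous_iff_continuousAt.2 fun x => (hs.hasDerivAt x).continuousAt

theorem eventually_abs_deriv_le (hs : IsSlowScale s s') (hκ : 0 < κ) :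
    ∀ᶠ x in cocompact ℝ, |s' x| ≤ κ := by
  have habs : Tendsto (fun x => |s' x|) (cocompact ℝ) (𝓝 0) := by simpa using hs.tendsto_deriv.abs
  exact habs.eventually (ge_mem_nhds hκ)

theorem exists_abs_deriv_le (hs : IsSlowScale s s') (hκ : 0 < κ) :
    ∃ L : ℝ, 0 ≤ L ∧ ∀ x, |s' x| ≤ κ + L * (s x / (1 + x ^ 2)) := by
  have hpos : ∀ x, 0 < s x / (1 + x ^ 2) := fun x => div_pos (hs.pos x) (by positivity)
  obtain ⟨K, hK, hKc⟩ := mem_cocompact.1 (hs.eventually_abs_deriv_le hκ)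
  obtain ⟨m, hm, hmK⟩ := hK.exists_forall_le' (f := fun x => s x / (1 + x ^ 2))
    (hs.continuous.div (by fun_prop) fun x => by positivity).continuousOn fun x _ => hpos x
  refine ⟨m⁻¹, by positivity, fun x => ?_⟩
  by_cases hx : x ∈ K
  · calc |s' x| ≤ m⁻¹ * m := by rw [inv_mul_cancel₀ hm.ne']; exact hs.abs_deriv_le_one x
      _ ≤ m⁻¹ * (s x / (1 + x ^ 2)) := by gcongr; exact hmK x hx
      _ ≤ κ + m⁻¹ * (s x / (1 + x ^ 2)) := le_add_of_nonneg_left hκ.le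
  · exact (show |s' x| ≤ κ from hKc hx).trans
      (le_add_of_nonneg_right (mul_nonneg (by positivity) (hpos x).le))

/- Multiplying `u` by the bounded factor `exp (L * (arctan x + π / 2))` compensates for the slope
of `s` on the compact set where it is not small. -/
theorem exists_damped (hs : IsSlowScale s s') (hu : ∀ x, HasDerivAt u (u' x) x)
    (hu0 : ∀ x, 0 < u x) (hκ : 0 < κ) (hgrow : ∀ x, κ * u x ≤ s x * u' x) :
    ∃ (w w' : ℝ → ℝ) (B : ℝ), (∀ x, HasDerivAt w (w' x) x) ∧ (∀ x, u x ≤ w x) ∧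
      (∀ x, w x ≤ B * u x) ∧ ∀ x, (κ / 2 + |s' x|) * w x ≤ s x * w' x := by
  obtain ⟨L, hL, hslope⟩ := hs.exists_abs_deriv_le (half_pos hκ)
  set E : ℝ → ℝ := fun x => Real.exp (L * (Real.arctan x + Real.pi / 2)) with hEdef
  have hE : ∀ x, HasDerivAt E (E x * (L * (1 / (1 + x ^ 2)))) x := fun x =>
    (((Real.hasDerivAt_arctan x).add_const _).const_mul L).exp
  have hE1 : ∀ x, 1 ≤ E x := fun x => Real.one_le_exp <|
    mul_nonneg hL (by linarith [Real.neg_pi_div_two_lt_arctan x])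
  have hEB : ∀ x, E x ≤ Real.exp (L * (Real.pi / 2 + Real.pi / 2)) := fun x => by
    simp only [hEdef]
    gcongr
    exact (Real.arctan_lt_pi_div_two x).le
  refine ⟨fun x => E x * u x, _, Real.exp (L * (Real.pi / 2 + Real.pi / 2)),
    fun x => (hE x).mul (hu x), fun x => ?_, fun x => ?_, fun x => ?_⟩
  · exact le_mul_of_one_le_left (hu0 x).le (hE1 x)
  · exact mul_le_mul_of_nonneg_right (hEB x) (hu0 x).le
  · have hE0 : 0 ≤ E x := zero_le_one.trans (hE1 x)
    calc (κ / 2 + |s' x|) * (E x * u x)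
        ≤ (κ + L * (s x / (1 + x ^ 2))) * (E x * u x) :=
          mul_le_mul_of_nonneg_right (by linarith [hslope x]) (mul_nonneg hE0 (hu0 x).le)
      _ = E x * (κ * u x) + s x * (E x * (L * (1 / (1 + x ^ 2))) * u x) := by ring
      _ ≤ E x * (s x * u' x) + s x * (E x * (L * (1 / (1 + x ^ 2))) * u x) :=
          add_le_add_left (mul_le_mul_of_nonneg_left (hgrow x) hE0) _
      _ = s x * (E x * (L * (1 / (1 + x ^ 2))) * u x + E x * u' x) := by ring

theorem lintegral_Iic_le_of_damped {w w' : ℝ → ℝ} (hs : IsSlowScale s s')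
    (hw : ∀ x, HasDerivAt w (w' x) x) (hw0 : ∀ x, 0 < w x) (hκ : 0 < κ)
    (hgrow : ∀ x, (κ + |s' x|) * w x ≤ s x * w' x) (x : ℝ) :
    ∫⁻ t in Iic x, ENNReal.ofReal (w t) ≤ ENNReal.ofReal (κ⁻¹ * (w x * s x)) := by
  have hwc : Continuous w := continuous_iff_continuousAt.2 fun t => (hw t).continuousAt
  refine lintegral_Iic_le_of_intervalIntegral_le hwc.locallyIntegrable
    (Eventually.of_forall fun t => (hw0 t).le) fun a ha =>
      intervalIntegral_le_of_le_deriv ha hwc.locallyIntegrable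
        (fun t => ((hw t).mul (hs.hasDerivAt t)).const_mul κ⁻¹)
        (fun t => mul_nonneg (inv_nonneg.2 hκ.le) (mul_pos (hw0 t) (hs.pos t)).le) fun t _ => ?_
  rw [le_inv_mul_iff₀ hκ]
  nlinarith [hgrow t, mul_le_mul_of_nonneg_left (neg_abs_le (s' t)) (hw0 t).le]

theorem lintegral_Iic_div_sq_le_of_damped {w w' : ℝ → ℝ} (hs : IsSlowScale s s')
    (hw : ∀ x, HasDerivAt w (w' x) x) (hw0 : ∀ x, 0 < w x) (hκ : 0 < κ)
    (hgrow : ∀ x, (κ + |s' x|) * w x ≤ s x * w' x) (x : ℝ) :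
    ∫⁻ t in Iic x, ENNReal.ofReal (w t / s t ^ 2) ≤ ENNReal.ofReal (κ⁻¹ * (w x / s x)) := by
  have hwc : Continuous w := continuous_iff_continuousAt.2 fun t => (hw t).continuousAt
  have hint : LocallyIntegrable (fun t => w t / s t ^ 2) volume :=
    (hwc.div (hs.continuous.pow 2) fun t => (pow_pos (hs.pos t) 2).ne').locallyIntegrable
  have hpos : ∀ t, 0 < w t / s t := fun t => div_pos (hw0 t) (hs.pos t)
  refine lintegral_Iic_le_of_intervalIntegral_le hint
    (Eventually.of_forall fun t => by have := hw0 t; positivity) fun a ha =>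
      intervalIntegral_le_of_le_deriv ha hint
        (fun t => ((hw t).fun_div (hs.hasDerivAt t) (hs.pos t).ne').const_mul κ⁻¹)
        (fun t => mul_nonneg (inv_nonneg.2 hκ.le) (hpos t).le) fun t _ => ?_
  rw [le_inv_mul_iff₀ hκ, mul_div_assoc']
  gcongr
  nlinarith [hgrow t, mul_le_mul_of_nonneg_left (le_abs_self (s' t)) (hw0 t).le]

theorem exists_lintegral_Iic_le (hs : IsSlowScale s s') (hu : ∀ x, HasDerivAt u (u' x) x)
    (hu0 : ∀ x, 0 < u x) (hκ : 0 < κ) (hgrow : ∀ x, κ * u x ≤ s x * u' x) :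
    ∃ C : ℝ, ∀ x, ∫⁻ t in Iic x, ENNReal.ofReal (u t) ≤ ENNReal.ofReal (C * (u x * s x)) ∧
      ∫⁻ t in Iic x, ENNReal.ofReal (u t / s t ^ 2) ≤ ENNReal.ofReal (C * (u x / s x)) := by
  obtain ⟨w, w', B, hw, huw, hwB, hdamp⟩ := hs.exists_damped hu hu0 hκ hgrow
  have hw0 : ∀ x, 0 < w x := fun x => (hu0 x).trans_le (huw x)
  refine ⟨(κ / 2)⁻¹ * B, fun x => ⟨?_, ?_⟩⟩
  · calc ∫⁻ t in Iic x, ENNReal.ofReal (u t) ≤ ∫⁻ t in Iic x, ENNReal.ofReal (w t) := by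
          gcongr with t
          exact huw t
      _ ≤ ENNReal.ofReal ((κ / 2)⁻¹ * (w x * s x)) :=
          hs.lintegral_Iic_le_of_damped hw hw0 (half_pos hκ) hdamp x
      _ ≤ ENNReal.ofReal ((κ / 2)⁻¹ * (B * u x * s x)) := by
          have := (hs.pos x).le
          gcongr
          exact hwB x
      _ = ENNReal.ofReal ((κ / 2)⁻¹ * B * (u x * s x)) := by ring_nf
  · calc ∫⁻ t in Iic x, ENNReal.ofReal (u t / s t ^ 2)
        ≤ ∫⁻ t in Iic x, ENNReal.ofReal (w t / s t ^ 2) := by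
          gcongr with t
          exact huw t
      _ ≤ ENNReal.ofReal ((κ / 2)⁻¹ * (w x / s x)) :=
          hs.lintegral_Iic_div_sq_le_of_damped hw hw0 (half_pos hκ) hdamp x
      _ ≤ ENNReal.ofReal ((κ / 2)⁻¹ * (B * u x / s x)) := by
          have := (hs.pos x).le
          gcongr
          exact hwB x
      _ = ENNReal.ofReal ((κ / 2)⁻¹ * B * (u x / s x)) := by ring_nf

theorem exists_eventually_mul_pow_three_le (hs : IsSlowScale s s')
    (hu : ∀ x, HasDerivAt u (u' x) x) (hu0 : ∀ x, 0 < u x) (hκ : 0 < κ)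
    (hgrow : ∀ x, κ * u x ≤ s x * u' x) :
    ∃ c : ℝ, 0 < c ∧ ∀ᶠ x in atTop, c * s x ^ 3 ≤ u x := by
  obtain ⟨X, hX⟩ := eventually_atTop.1
    ((hs.eventually_abs_deriv_le (by positivity : 0 < κ / 3)).filter_mono atTop_le_cocompact)
  have hderiv : ∀ x, HasDerivAt (fun x => u x / s x ^ 3)
      (s x ^ 2 * (s x * u' x - 3 * s' x * u x) / (s x ^ 3) ^ 2) x := fun x => by
    refine ((hu x).fun_div ((hs.hasDerivAt x).fun_pow 3)
      (pow_pos (hs.pos x) 3).ne').congr_deriv ?_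
    push_cast
    ring
  have hmono : MonotoneOn (fun x => u x / s x ^ 3) (Ici X) := by
    refine monotoneOn_of_hasDerivWithinAt_nonneg (convex_Ici X)
      (fun x _ => (hderiv x).continuousAt.continuousWithinAt)
      (fun x _ => (hderiv x).hasDerivWithinAt) fun x hx => ?_
    have hslope := (le_abs_self _).trans (hX x (interior_subset hx))
    have : 0 ≤ s x * u' x - 3 * s' x * u x := by nlinarith [hgrow x, hu0 x]
    positivity
  refine ⟨u X / s X ^ 3, div_pos (hu0 X) (pow_pos (hs.pos X) 3), ?_⟩
  filter_upwards [eventually_ge_atTop X] with x hx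
  exact (le_div_iff₀ (pow_pos (hs.pos x) 3)).1 (hmono self_mem_Ici hx hx)

/- Since `u ≥ c s ^ 3` near `+∞`, one has `(u / s ^ 2) ^ 3 ≥ c ^ 2 u`. -/
theorem tendsto_div_sq_atTop (hs : IsSlowScale s s') (hu : ∀ x, HasDerivAt u (u' x) x)
    (hu0 : ∀ x, 0 < u x) (hκ : 0 < κ) (hgrow : ∀ x, κ * u x ≤ s x * u' x)
    (htop : Tendsto u atTop atTop) : Tendsto (fun x => u x / s x ^ 2) atTop atTop := by
  obtain ⟨c, hc, hcube⟩ := hs.exists_eventually_mul_pow_three_le hu hu0 hκ hgrow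
  refine tendsto_atTop.2 fun M => ?_
  filter_upwards [hcube, htop.eventually_ge_atTop (|M| ^ 3 / c ^ 2)] with x hx hM
  have hux := hu0 x
  have hsx := hs.pos x
  rw [div_le_iff₀' (by positivity)] at hM
  refine (le_abs_self M).trans ?_
  rw [← pow_le_pow_iff_left₀ (abs_nonneg M) (by positivity) three_ne_zero]
  calc |M| ^ 3 ≤ c ^ 2 * u x := hM
    _ = (c * s x ^ 3) ^ 2 * u x / (s x ^ 2) ^ 3 := by field_simp
    _ ≤ u x ^ 2 * u x / (s x ^ 2) ^ 3 := by gcongr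
    _ = (u x / s x ^ 2) ^ 3 := by rw [div_pow]; ring

end IsSlowScale

/-- `u` is a positive increasing solution of `u'' = q u` which grows exponentially at the length
scale `s`, in the integrated form used for kernel estimates. -/
structure IsGrowingSolution (q s u u' : ℝ → ℝ) (C : ℝ) : Prop where
  isHomogeneousSolution : IsHomogeneousSolution q u u'
  pos : ∀ x, 0 < u x
  deriv_pos : ∀ x, 0 < u' x
  le_mul_deriv : ∀ x, u x ≤ C * (s x * u' x)
  lintegral_le : ∀ x, ∫⁻ t in Iic x, ENNReal.ofReal (u t) ≤ ENNReal.ofReal (C * (u x * s x))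
  lintegral_div_sq_le : ∀ x,
    ∫⁻ t in Iic x, ENNReal.ofReal (u t / s t ^ 2) ≤ ENNReal.ofReal (C * (u x / s x))
  tendsto_div_sq : Tendsto (fun x => u x / s x ^ 2) atTop atTop

theorem IsGrowingSolution.mono {q s u u' : ℝ → ℝ} {C D : ℝ} (hu : IsGrowingSolution q s u u' C)
    (hs : ∀ x, 0 < s x) (hCD : C ≤ D) : IsGrowingSolution q s u u' D where
  isHomogeneousSolution := hu.isHomogeneousSolution
  pos := hu.pos
  deriv_pos := hu.deriv_pos
  le_mul_deriv x := (hu.le_mul_deriv x).trans <|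
    mul_le_mul_of_nonneg_right hCD (mul_pos (hs x) (hu.deriv_pos x)).le
  lintegral_le x := (hu.lintegral_le x).trans <| ENNReal.ofReal_le_ofReal <|
    mul_le_mul_of_nonneg_right hCD (mul_pos (hu.pos x) (hs x)).le
  lintegral_div_sq_le x := (hu.lintegral_div_sq_le x).trans <| ENNReal.ofReal_le_ofReal <|
    mul_le_mul_of_nonneg_right hCD (div_pos (hu.pos x) (hs x)).le
  tendsto_div_sq := hu.tendsto_div_sq

theorem IsHomogeneousSolution.tendsto_atTop {q u u' : ℝ → ℝ} (hq0 : ∀ᵐ x : ℝ, 0 ≤ q x)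
    (hu : IsHomogeneousSolution q u u') (hu0 : ∀ x, 0 < u x) (hu'0 : ∀ x, 0 < u' x) :
    Tendsto u atTop atTop := by
  refine tendsto_atTop_mono' atTop ?_ (tendsto_id.const_mul_atTop (hu'0 0))
  filter_upwards [eventually_ge_atTop 0] with x hx
  have := (sub_mem_Icc_of_monotone_deriv hu.hasDerivAt
    (hu.monotone_deriv hq0 fun x => (hu0 x).le) hx).1
  simp only [id]
  linarith [hu0 0]

theorem IsSlowScale.exists_growth_rate {q s s' u u' : ℝ → ℝ} (hs : IsSlowScale s s')
    (hq : LocallyIntegrable q volume) (hq0 : ∀ᵐ x : ℝ, 0 ≤ q x)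
    (hu : IsHomogeneousSolution q u u') (hu0 : ∀ x, 0 < u x) (hu'0 : ∀ x, 0 < u' x)
    (hmass : ∀ᶠ x in cocompact ℝ, 1 ≤ 2 * s x * ∫ t in (x - s x)..x, q t) :
    ∃ κ : ℝ, 0 < κ ∧ ∀ x, κ * u x ≤ s x * u' x := by
  obtain ⟨κ, hκ, hle⟩ := exists_pos_forall_le_of_eventually_cocompact
    (g := fun x => s x * u' x / u x) (c := 1 / 3)
    ((hs.continuous.mul hu.isPrimitive_deriv.continuous).div hu.continuous fun x => (hu0 x).ne')
    (fun x => div_pos (mul_pos (hs.pos x) (hu'0 x)) (hu0 x)) (by norm_num) <| by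
      filter_upwards [hmass] with x hx
      rw [le_div_iff₀ (hu0 x)]
      linarith [hu.le_three_mul hq hq0 (fun t => (hu0 t).le) (fun t => (hu'0 t).le)
        (hs.pos x).le hx]
  exact ⟨κ, hκ, fun x => (le_div_iff₀ (hu0 x)).1 (hle x)⟩

theorem IsSlowScale.exists_isGrowingSolution {q s s' : ℝ → ℝ} (hs : IsSlowScale s s')
    (hq : LocallyIntegrable q volume) (hq0 : ∀ᵐ x : ℝ, 0 ≤ q x)
    (htail : ∀ x, ∃ a < x, 0 < ∫ t in a..x, q t)
    (hmass : ∀ᶠ x in cocompact ℝ, 1 ≤ 2 * s x * ∫ t in (x - s x)..x, q t) :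
    ∃ (u u' : ℝ → ℝ) (C : ℝ), IsGrowingSolution q s u u' C := by
  obtain ⟨u, u', hu, hu0, hu'0⟩ := exists_isHomogeneousSolution_pos_deriv_pos hq hq0 htail
  obtain ⟨κ, hκ, hgrow⟩ := hs.exists_growth_rate hq hq0 hu hu0 hu'0 hmass
  obtain ⟨C, hC⟩ := hs.exists_lintegral_Iic_le hu.hasDerivAt hu0 hκ hgrow
  have hsol : IsGrowingSolution q s u u' (max κ⁻¹ C) := by
    refine ⟨hu, hu0, hu'0, fun x => ?_, fun x => (hC x).1.trans ?_, fun x => (hC x).2.trans ?_,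
      hs.tendsto_div_sq_atTop hu.hasDerivAt hu0 hκ hgrow (hu.tendsto_atTop hq0 hu0 hu'0)⟩
    · refine ((le_inv_mul_iff₀ hκ).2 (hgrow x)).trans ?_
      exact mul_le_mul_of_nonneg_right (le_max_left _ _) (mul_pos (hs.pos x) (hu'0 x)).le
    · exact ENNReal.ofReal_le_ofReal <|
        mul_le_mul_of_nonneg_right (le_max_right _ _) (mul_pos (hu0 x) (hs.pos x)).le
    · exact ENNReal.ofReal_le_ofReal <|
        mul_le_mul_of_nonneg_right (le_max_right _ _) (div_pos (hu0 x) (hs.pos x)).le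
  exact ⟨u, u', _, hsol⟩

section Standard

variable {q : ℝ → ℝ}

theorem InClassH.tendsto_imbalance (hq : LocallyIntegrable q volume) (hH : InClassH q) :
    Tendsto (imbalance (fun x => ∫ t in (0 : ℝ)..x, q t) (otelbaevScale q)) (cocompact ℝ)
      (𝓝 0) := by
  rw [funext (imbalance_otelbaevScale hq), cocompact_eq_atBot_atTop]
  simpa using Tendsto.const_mul (Real.sqrt 2) hH

theorem isSlowScale_otelbaevScale (hq : LocallyIntegrable q volume) (hq0 : ∀ᵐ x : ℝ, 0 ≤ q x)
    (ht : PositiveTails q) (hH : InClassH q) :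
    IsSlowScale (otelbaevScale q)
      (scaleSlope (fun x => ∫ t in (0 : ℝ)..x, q t) (otelbaevScale q)) := by
  have hs := isOtelbaevScale hq hq0 ht
  have hderiv := hs.hasDerivAt_scale
  refine ⟨hderiv, hs.pos, fun x => ?_, ?_⟩
  · rw [← (hderiv x).deriv]
    exact norm_deriv_le_of_lipschitz hs.lipschitzWith_one
  · have habs := ((hH.tendsto_imbalance hq).abs.div_const 2)
    rw [abs_zero, zero_div] at habs
    exact squeeze_zero_norm hs.abs_scaleSlope_le habs

theorem exists_isGrowingSolution_otelbaevScale (hq : LocallyIntegrable q volume)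
    (hq0 : ∀ᵐ x : ℝ, 0 ≤ q x) (ht : PositiveTails q) (hH : InClassH q) :
    ∃ (u u' : ℝ → ℝ) (C : ℝ), IsGrowingSolution q (otelbaevScale q) u u' C := by
  refine (isSlowScale_otelbaevScale hq hq0 ht hH).exists_isGrowingSolution hq hq0
    (exists_intervalIntegral_pos hq hq0 ht) ?_
  filter_upwards [(hH.tendsto_imbalance hq).eventually_le_const one_pos] with x hx
  rw [(IsPrimitive.of_locallyIntegrable hq 0).integral_eq_sub]
  exact (isOtelbaevScale hq hq0 ht).one_le_two_mul_mul_sub_left hx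

end Standard

/-! ### The Schur test -/

section Schur

variable {α β : Type*} [MeasurableSpace α] [MeasurableSpace β] {D : ℝ≥0∞} {p : ℝ≥0∞}

theorem rpow_lintegral_mul_le {μ : Measure α} {k g : α → ℝ≥0∞} (hk : AEMeasurable k μ)
    (hg : AEMeasurable g μ) (hD : ∫⁻ t, k t ∂μ ≤ D) {r : ℝ} (hr : 1 ≤ r) :
    (∫⁻ t, k t * g t ∂μ) ^ r ≤ D ^ (r - 1) * ∫⁻ t, k t * g t ^ r ∂μ := by
  have hr0 : 0 < r := zero_lt_one.trans_le hr
  have hjensen := eLpNorm'_le_eLpNorm'_mul_rpow_measure_univ (μ := μ.withDensity k) zero_lt_one hr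
    (hg.mono_ac (withDensity_absolutelyContinuous _ _)).aestronglyMeasurable
  simp only [eLpNorm'_eq_lintegral_enorm, enorm_eq_self, ENNReal.rpow_one, div_one] at hjensen
  rw [lintegral_withDensity_eq_lintegral_mul₀ hk hg,
    lintegral_withDensity_eq_lintegral_mul₀ hk (hg.pow_const r),
    withDensity_apply _ MeasurableSet.univ, Measure.restrict_univ] at hjensen
  calc (∫⁻ t, k t * g t ∂μ) ^ r
      ≤ ((∫⁻ t, k t * g t ^ r ∂μ) ^ (1 / r) * (∫⁻ t, k t ∂μ) ^ (1 - 1 / r)) ^ r :=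
        ENNReal.rpow_le_rpow hjensen hr0.le
    _ = (∫⁻ t, k t ∂μ) ^ (r - 1) * ∫⁻ t, k t * g t ^ r ∂μ := by
        rw [ENNReal.mul_rpow_of_nonneg _ _ hr0.le, ← ENNReal.rpow_mul, ← ENNReal.rpow_mul,
          one_div_mul_cancel hr0.ne', ENNReal.rpow_one, mul_comm,
          show (1 - 1 / r) * r = r - 1 by field_simp]
    _ ≤ D ^ (r - 1) * ∫⁻ t, k t * g t ^ r ∂μ := by gcongr

variable {μ : Measure α} {ν : Measure β} [SFinite μ] [SFinite ν] {K : α → β → ℝ≥0∞}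
  {g : β → ℝ≥0∞}

theorem lintegral_rpow_lintegral_mul_le (hK : Measurable (Function.uncurry K))
    (hrow : ∀ x, ∫⁻ t, K x t ∂ν ≤ D) (hcol : ∀ t, ∫⁻ x, K x t ∂μ ≤ D) (hg : AEMeasurable g ν)
    {r : ℝ} (hr : 1 ≤ r) :
    ∫⁻ x, (∫⁻ t, K x t * g t ∂ν) ^ r ∂μ ≤ D ^ r * ∫⁻ t, g t ^ r ∂ν := by
  have hm : AEMeasurable (Function.uncurry fun x t => K x t * g t ^ r) (μ.prod ν) :=
    hK.aemeasurable.mul (hg.pow_const r).comp_snd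
  calc ∫⁻ x, (∫⁻ t, K x t * g t ∂ν) ^ r ∂μ
      ≤ ∫⁻ x, D ^ (r - 1) * ∫⁻ t, K x t * g t ^ r ∂ν ∂μ := lintegral_mono fun x =>
        rpow_lintegral_mul_le (hK.comp measurable_prodMk_left).aemeasurable hg (hrow x) hr
    _ = D ^ (r - 1) * ∫⁻ t, (∫⁻ x, K x t ∂μ) * g t ^ r ∂ν := by
        rw [lintegral_const_mul'' _ (f := fun x => ∫⁻ t, K x t * g t ^ r ∂ν)
          hm.lintegral_prod_right', lintegral_lintegral_swap hm]
        exact congrArg _ <| lintegral_congr fun t =>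
          lintegral_mul_const _ (hK.comp measurable_prodMk_right)
    _ ≤ D ^ (r - 1) * ∫⁻ t, D * g t ^ r ∂ν := by
        gcongr with t
        exact hcol t
    _ = D ^ r * ∫⁻ t, g t ^ r ∂ν := by
        rw [lintegral_const_mul'' _ (hg.pow_const r), ← mul_assoc]
        nth_rw 2 [← ENNReal.rpow_one D]
        rw [← ENNReal.rpow_add_of_nonneg _ _ (by linarith) zero_le_one, sub_add_cancel]

theorem eLpNorm_lintegral_mul_le (hK : Measurable (Function.uncurry K))
    (hrow : ∀ x, ∫⁻ t, K x t ∂ν ≤ D) (hcol : ∀ t, ∫⁻ x, K x t ∂μ ≤ D) (hg : AEMeasurable g ν)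
    (hp : 1 ≤ p) : eLpNorm (fun x => ∫⁻ t, K x t * g t ∂ν) p μ ≤ D * eLpNorm g p ν := by
  rcases eq_or_ne p ∞ with rfl | hp_top
  · simp only [eLpNorm_exponent_top, eLpNormEssSup_eq_essSup_enorm, enorm_eq_self]
    refine essSup_le_of_ae_le _ (Eventually.of_forall fun x => ?_)
    calc ∫⁻ t, K x t * g t ∂ν ≤ ∫⁻ t, K x t * essSup g ν ∂ν :=
          lintegral_mono_ae <| (ENNReal.ae_le_essSup g).mono fun t ht => by gcongr
      _ = (∫⁻ t, K x t ∂ν) * essSup g ν :=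
          lintegral_mul_const _ (hK.comp measurable_prodMk_left)
      _ ≤ D * essSup g ν := by gcongr; exact hrow x
  · have hp0 : p ≠ 0 := (zero_lt_one.trans_le hp).ne'
    have hr0 : 0 < p.toReal := ENNReal.toReal_pos hp0 hp_top
    have hr : 1 ≤ p.toReal := by simpa using ENNReal.toReal_mono hp_top hp
    simp only [eLpNorm_eq_lintegral_rpow_enorm_toReal hp0 hp_top, enorm_eq_self]
    rw [one_div, ENNReal.rpow_inv_le_iff hr0, ENNReal.mul_rpow_of_nonneg _ _ hr0.le,
      ← ENNReal.rpow_mul, inv_mul_cancel₀ hr0.ne', ENNReal.rpow_one]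
    exact lintegral_rpow_lintegral_mul_le hK hrow hcol hg hr

theorem eLpNorm_mul_setLIntegral_Iic_le {μ : Measure ℝ} [SFinite μ] {a b g : ℝ → ℝ≥0∞}
    (ha : Measurable a) (hb : Measurable b) (hrow : ∀ x, a x * ∫⁻ t in Iic x, b t ∂μ ≤ D)
    (hcol : ∀ t, b t * ∫⁻ x in Ici t, a x ∂μ ≤ D) (hg : AEMeasurable g μ) (hp : 1 ≤ p) :
    eLpNorm (fun x => a x * ∫⁻ t in Iic x, b t * g t ∂μ) p μ ≤ D * eLpNorm g p μ := by
  set K : ℝ → ℝ → ℝ≥0∞ := fun x t => if t ≤ x then a x * b t else 0 with hKdef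
  have hK : Measurable (Function.uncurry K) :=
    Measurable.ite (measurableSet_le measurable_snd measurable_fst) (by fun_prop) measurable_const
  have hKrow : ∀ x (h : ℝ → ℝ≥0∞), ∫⁻ t, K x t * h t ∂μ = ∫⁻ t in Iic x, a x * (b t * h t) ∂μ :=
    fun x h => by
      rw [← lintegral_indicator measurableSet_Iic]
      simp only [hKdef, indicator_apply, mem_Iic, ite_mul, zero_mul, mul_assoc]
  have hKcol : ∀ t, ∫⁻ x, K x t ∂μ = b t * ∫⁻ x in Ici t, a x ∂μ := fun t => by
    rw [← lintegral_const_mul _ ha, ← lintegral_indicator measurableSet_Ici]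
    simp only [hKdef, indicator_apply, mem_Ici, mul_comm]
  have hKg : (fun x => a x * ∫⁻ t in Iic x, b t * g t ∂μ) = fun x => ∫⁻ t, K x t * g t ∂μ :=
    funext fun x => by
      rw [hKrow, lintegral_const_mul'' _ (f := fun t => b t * g t)
        (hb.aemeasurable.mul hg.restrict)]
  rw [hKg]
  refine eLpNorm_lintegral_mul_le hK (fun x => ?_) (fun t => (hKcol t).trans_le (hcol t)) hg hp
  have hrow' := hKrow x fun _ => 1
  simp only [mul_one] at hrow'
  rw [hrow', lintegral_const_mul _ hb]
  exact hrow x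

end Schur

section Integrability

variable {α : Type*} [MeasurableSpace α] {μ : Measure α} {p : ℝ≥0∞}

/- With respect to the finite measure `w μ`, which is dominated by `M μ`, the function `f` is in
`L_p` and hence in `L_1`. -/
theorem integrable_mul_of_memLp {w f : α → ℝ} {M : ℝ} (hw : Integrable w μ)
    (hw0 : ∀ᵐ t ∂μ, 0 ≤ w t) (hM : ∀ᵐ t ∂μ, w t ≤ M) (hp : 1 ≤ p) (hf : MemLp f p μ) :
    Integrable (fun t => w t * f t) μ := by
  have : IsFiniteMeasure (μ.withDensity fun t => ENNReal.ofReal (w t)) :=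
    isFiniteMeasure_withDensity_ofReal hw.2
  have hle : (μ.withDensity fun t => ENNReal.ofReal (w t)) ≤ ENNReal.ofReal M • μ := by
    rw [← withDensity_const]
    exact withDensity_mono (hM.mono fun t ht => ENNReal.ofReal_le_ofReal ht)
  have hint := memLp_one_iff_integrable.1
    ((hf.of_measure_le_smul ENNReal.ofReal_ne_top hle).mono_exponent hp)
  rw [integrable_withDensity_iff_integrable_smul₀' hw.aemeasurable.ennreal_ofReal
    (Eventually.of_forall fun _ => ENNReal.ofReal_lt_top)] at hint
  refine hint.congr (hw0.mono fun t ht => ?_)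
  simp only [ENNReal.toReal_ofReal ht, smul_eq_mul]

theorem integrable_of_lintegral_ofReal_le {w : α → ℝ} {c : ℝ} (hw : AEStronglyMeasurable w μ)
    (hw0 : ∀ᵐ t ∂μ, 0 ≤ w t) (hle : ∫⁻ t, ENNReal.ofReal (w t) ∂μ ≤ ENNReal.ofReal c) :
    Integrable w μ :=
  ⟨hw, (hasFiniteIntegral_iff_ofReal hw0).2 (hle.trans_lt ENNReal.ofReal_lt_top)⟩

theorem not_memLp_of_tendsto_norm_atTop {f : ℝ → ℝ} (hp : p ≠ 0)
    (hf : Tendsto (fun x => ‖f x‖) atTop atTop) : ¬ MemLp f p volume := by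
  intro hmem
  obtain ⟨X, hX⟩ := eventually_atTop.1
    (hf.eventually_ge_atTop ((eLpNorm f p volume).toReal + 1))
  have hle := ofReal_mul_measure_rpow_le_eLpNorm (μ := volume) hp measurableSet_Ici (by simp)
    (by positivity) hX
  have hone : 1 ≤ volume (Ici X) ^ (1 / p.toReal) := by
    rw [← ENNReal.one_rpow (1 / p.toReal)]
    exact ENNReal.rpow_le_rpow (by simp) (by positivity)
  have := (le_mul_of_one_le_right' hone).trans hle
  rw [ENNReal.ofReal_le_iff_le_toReal hmem.2.ne] at this
  linarith

end Integrability

/-! ### The Green function -/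

/-- The data of the Green function of `-y'' + q y`: a growing solution `u` on the length scale `s`,
and a decaying solution, recorded as the growing solution `v` of the equation reflected in the
origin, so that the decaying solution itself is `fun x => v (-x)`. Their Wronskian is `W`. -/
structure IsGreenPair (q s u u' v v' : ℝ → ℝ) (W C : ℝ) : Prop where
  scale_continuous : Continuous s
  scale_pos : ∀ x, 0 < s x
  left : IsGrowingSolution q s u u' C
  right : IsGrowingSolution (fun x => q (-x)) (fun x => s (-x)) v v' C
  wronskian : ∀ x, u' x * v (-x) + u x * v' (-x) = W

theorem exists_isGreenPair {q : ℝ → ℝ} (hq : LocallyIntegrable q volume)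
    (hq0 : ∀ᵐ x : ℝ, 0 ≤ q x) (ht : PositiveTails q) (hH : InClassH q) :
    ∃ (u u' v v' : ℝ → ℝ) (W C : ℝ), IsGreenPair q (otelbaevScale q) u u' v v' W C := by
  have hs := isSlowScale_otelbaevScale hq hq0 ht hH
  obtain ⟨u, u', C, hu⟩ := exists_isGrowingSolution_otelbaevScale hq hq0 ht hH
  obtain ⟨v, v', D, hv⟩ := exists_isGrowingSolution_otelbaevScale (locallyIntegrable_comp_neg hq)
    (ae_nonneg_comp_neg hq0) ht.comp_neg hH.comp_neg
  simp only [funext (otelbaevScale_comp_neg q)] at hv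
  refine ⟨u, u', v, v', u' 0 * v 0 + u 0 * v' 0, max C D, hs.continuous, hs.pos,
    hu.mono hs.pos (le_max_left _ _), hv.mono (fun x => hs.pos _) (le_max_right _ _), fun x => ?_⟩
  have hv_neg := hv.isHomogeneousSolution.comp_neg
  simp only [neg_neg] at hv_neg
  simpa only [mul_neg, sub_neg_eq_add, neg_zero] using
    hu.isHomogeneousSolution.wronskian_eq hv_neg x 0

namespace IsGreenPair

variable {q s u u' v v' f : ℝ → ℝ} {W C : ℝ} {p : ℝ≥0∞}

theorem reflect (h : IsGreenPair q s u u' v v' W C) :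
    IsGreenPair (fun x => q (-x)) (fun x => s (-x)) v v' u u' W C where
  scale_continuous := h.scale_continuous.comp continuous_neg
  scale_pos x := h.scale_pos (-x)
  left := h.right
  right := by simpa only [neg_neg] using h.left
  wronskian x := by rw [← h.wronskian (-x), neg_neg]; ring

theorem isHomogeneousSolution_right (h : IsGreenPair q s u u' v v' W C) :
    IsHomogeneousSolution q (fun x => v (-x)) fun x => -v' (-x) := by
  simpa only [neg_neg] using h.right.isHomogeneousSolution.comp_neg

theorem wronskian_pos (h : IsGreenPair q s u u' v v' W C) : 0 < W := by
  rw [← h.wronskian 0]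
  exact add_pos (mul_pos (h.left.deriv_pos _) (h.right.pos _))
    (mul_pos (h.left.pos _) (h.right.deriv_pos _))

theorem const_pos (h : IsGreenPair q s u u' v v' W C) : 0 < C :=
  pos_of_mul_pos_left ((h.left.pos 0).trans_le (h.left.le_mul_deriv 0))
    (mul_pos (h.scale_pos 0) (h.left.deriv_pos 0)).le

theorem mul_le_mul_scale (h : IsGreenPair q s u u' v v' W C) (x : ℝ) :
    u x * v (-x) ≤ C * W * s x := by
  have hCs : 0 ≤ C * s x := (mul_pos h.const_pos (h.scale_pos x)).le
  have huv' : 0 ≤ u x * v' (-x) := (mul_pos (h.left.pos x) (h.right.deriv_pos _)).le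
  calc u x * v (-x) ≤ C * (s x * u' x) * v (-x) :=
        mul_le_mul_of_nonneg_right (h.left.le_mul_deriv x) (h.right.pos _).le
    _ = C * s x * (u' x * v (-x)) := by ring
    _ ≤ C * s x * W := by
        gcongr
        linarith [h.wronskian x]
    _ = C * W * s x := by ring

theorem monotone_left (h : IsGreenPair q s u u' v v' W C) : Monotone u :=
  monotone_of_hasDerivAt_nonneg h.left.isHomogeneousSolution.hasDerivAt fun x =>
    (h.left.deriv_pos x).le

section Uniqueness

variable {y y' : ℝ → ℝ}

theorem wronskian_mul_eq (h : IsGreenPair q s u u' v v' W C) (hy : IsHomogeneousSolution q y y')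
    (x : ℝ) : W * y x = (y' 0 * v 0 + y 0 * v' 0) * u x
      - (y' 0 * u 0 - y 0 * u' 0) * v (-x) := by
  have hα := hy.wronskian_eq h.isHomogeneousSolution_right x 0
  rw [neg_zero] at hα
  have hβ := hy.wronskian_eq h.left.isHomogeneousSolution x 0
  linear_combination u x * hα - v (-x) * hβ - y x * h.wronskian x

theorem tendsto_norm_div_sq_mul_atTop (h : IsGreenPair q s u u' v v' W C)
    (hq0 : ∀ᵐ x : ℝ, 0 ≤ q x) (hy : IsHomogeneousSolution q y y')
    (hα : y' 0 * v 0 + y 0 * v' 0 ≠ 0) :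
    Tendsto (fun x => ‖2 / s x ^ 2 * y x‖) atTop atTop := by
  have hW := h.wronskian_pos
  set α := y' 0 * v 0 + y 0 * v' 0
  set β := y' 0 * u 0 - y 0 * u' 0
  have hα0 : 0 < |α| := abs_pos.2 hα
  have hu := h.left.isHomogeneousSolution.tendsto_atTop hq0 h.left.pos h.left.deriv_pos
  refine tendsto_atTop_mono' atTop ?_ (h.left.tendsto_div_sq.const_mul_atTop (div_pos hα0 hW))
  filter_upwards [eventually_ge_atTop 0,
    (hu.const_mul_atTop hα0).eventually_ge_atTop (2 * (|β| * v 0))] with x hx hux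
  have hv : v (-x) ≤ v 0 := h.reflect.monotone_left (neg_nonpos.2 hx)
  have hWy : |α| * u x / 2 ≤ W * |y x| := by
    have := abs_sub_abs_le_abs_sub (α * u x) (β * v (-x))
    rw [← h.wronskian_mul_eq hy x, abs_mul, abs_mul, abs_mul, abs_of_pos hW,
      abs_of_pos (h.left.pos x), abs_of_pos (h.right.pos (-x))] at this
    linarith [mul_le_mul_of_nonneg_left hv (abs_nonneg β)]
  rw [norm_mul, Real.norm_of_nonneg (by positivity), Real.norm_eq_abs]
  calc |α| / W * (u x / s x ^ 2) = 2 / s x ^ 2 * (|α| * u x / 2 / W) := by ring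
    _ ≤ 2 / s x ^ 2 * |y x| := by
        gcongr
        rwa [div_le_iff₀' hW]

theorem wronskian_eq_zero_of_memLp (h : IsGreenPair q s u u' v v' W C)
    (hq0 : ∀ᵐ x : ℝ, 0 ≤ q x) (hp : p ≠ 0) (hy : IsHomogeneousSolution q y y')
    (hm : MemLp (fun x => 2 / s x ^ 2 * y x) p volume) :
    y' 0 * v 0 + y 0 * v' 0 = 0 := by
  by_contra hα
  exact not_memLp_of_tendsto_norm_atTop hp (h.tendsto_norm_div_sq_mul_atTop hq0 hy hα) hm

theorem eq_zero_of_memLp (h : IsGreenPair q s u u' v v' W C) (hq0 : ∀ᵐ x : ℝ, 0 ≤ q x)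
    (hp : p ≠ 0) (hy : IsHomogeneousSolution q y y')
    (hm : MemLp (fun x => 2 / s x ^ 2 * y x) p volume) (x : ℝ) : y x = 0 := by
  have hα := h.wronskian_eq_zero_of_memLp hq0 hp hy hm
  have hβ := h.reflect.wronskian_eq_zero_of_memLp (ae_nonneg_comp_neg hq0) hp hy.comp_neg
    (hm.comp_measurePreserving (Measure.measurePreserving_neg volume))
  have hWy := h.wronskian_mul_eq hy x
  have hβ' : y' 0 * u 0 - y 0 * u' 0 = 0 := by
    rw [neg_zero] at hβ
    linarith
  rw [hα, hβ', zero_mul, zero_mul, sub_zero] at hWy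
  exact (mul_eq_zero.1 hWy).resolve_left h.wronskian_pos.ne'

theorem eq_of_isSolution (h : IsGreenPair q s u u' v v' W C) (hq0 : ∀ᵐ x : ℝ, 0 ≤ q x)
    (hp : p ≠ 0) {y₁ y₂ : ℝ → ℝ} (hy₁ : IsSolution q f y₁) (hy₂ : IsSolution q f y₂)
    (hm₁ : MemLp (fun x => 2 / s x ^ 2 * y₁ x) p volume)
    (hm₂ : MemLp (fun x => 2 / s x ^ 2 * y₂ x) p volume) : y₁ = y₂ := by
  have hdiff : IsHomogeneousSolution q (fun x => y₁ x - y₂ x) fun x => deriv y₁ x - deriv y₂ x :=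
    ⟨fun x => (hy₁.1 x).hasDerivAt.sub (hy₂.1 x).hasDerivAt,
      ((isPrimitive_deriv_of_isSolution hy₁).sub (isPrimitive_deriv_of_isSolution hy₂)).congr_ae
        (Eventually.of_forall fun x => by ring)⟩
  funext x
  refine sub_eq_zero.1 (h.eq_zero_of_memLp hq0 hp hdiff ?_ x)
  simp only [mul_sub]
  exact hm₁.sub hm₂

end Uniqueness

end IsGreenPair

/-- The integral operator with kernel `u (min x t) * v (-max x t) / W`, the Green function of
`-y'' + q y` when `u` and `v` form a Green pair with Wronskian `W`. -/
noncomputable def greenOperator (u v : ℝ → ℝ) (W : ℝ) (f : ℝ → ℝ) (x : ℝ) : ℝ :=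
  1 / W * (v (-x) * (∫ t in Iic x, u t * f t) + u x * ∫ t in Iic (-x), v t * f (-t))

namespace IsGreenPair

variable {q s u u' v v' f : ℝ → ℝ} {W C : ℝ} {p : ℝ≥0∞}

theorem integrableOn_mul (h : IsGreenPair q s u u' v v' W C) (hp : 1 ≤ p)
    (hf : MemLp f p volume) (x : ℝ) : IntegrableOn (fun t => u t * f t) (Iic x) := by
  have hu0 : ∀ t, 0 ≤ u t := fun t => (h.left.pos t).le
  have hu : IntegrableOn u (Iic x) := integrable_of_lintegral_ofReal_le
    h.left.isHomogeneousSolution.continuous.aestronglyMeasurable (Eventually.of_forall hu0)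
    (h.left.lintegral_le x)
  exact integrable_mul_of_memLp hu (Eventually.of_forall hu0)
    ((ae_restrict_mem measurableSet_Iic).mono fun t ht => h.monotone_left ht) hp (hf.restrict _)

theorem isSolution_greenOperator (h : IsGreenPair q s u u' v v' W C)
    (hu : ∀ x, IntegrableOn (fun t => u t * f t) (Iic x))
    (hv : ∀ x, IntegrableOn (fun t => v t * f (-t)) (Iic x)) :
    IsSolution q f (greenOperator u v W f) := by
  have hW := h.wronskian_pos.ne'
  have hA := IsPrimitive.setIntegral_Iic hu
  have hB := (IsPrimitive.setIntegral_Iic hv).comp_neg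
  set A : ℝ → ℝ := fun x => ∫ t in Iic x, u t * f t
  set B : ℝ → ℝ := fun x => ∫ t in Iic x, v t * f (-t)
  simp only [neg_neg] at hB
  have hleft := h.left.isHomogeneousSolution
  have hright := h.isHomogeneousSolution_right
  have hy : IsPrimitive (greenOperator u v W f)
      (fun x => 1 / W * (-v' (-x) * A x + u' x * B (-x))) :=
    (((hright.isPrimitive.mul hA).add (hleft.isPrimitive.mul hB)).const_mul (1 / W)).congr_ae
      (Eventually.of_forall fun x => by ring)
  have hy' : IsPrimitive (fun x => 1 / W * (-v' (-x) * A x + u' x * B (-x)))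
      (fun x => q x * greenOperator u v W f x - f x) :=
    (((hright.isPrimitive_deriv.mul hA).add (hleft.isPrimitive_deriv.mul hB)).const_mul
      (1 / W)).congr_ae (Eventually.of_forall fun x => by
        simp only [greenOperator]
        field_simp
        linear_combination (-f x) * h.wronskian x)
  exact isSolution_of_isPrimitive (hy.hasDerivAt hy'.continuous) hy'
    (Eventually.of_forall fun x => by ring)

theorem mul_div_scale_le (h : IsGreenPair q s u u' v v' W C) (x : ℝ) :
    C * (u x * v (-x) / s x) ≤ C ^ 2 * W := by
  have hC := h.const_pos
  calc C * (u x * v (-x) / s x) ≤ C * (C * W) :=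
        mul_le_mul_of_nonneg_left ((div_le_iff₀ (h.scale_pos x)).2 (h.mul_le_mul_scale x)) hC.le
    _ = C ^ 2 * W := by ring

theorem ofReal_mul_lintegral_Iic_le (h : IsGreenPair q s u u' v v' W C) (x : ℝ) :
    ENNReal.ofReal (v (-x) / s x ^ 2) * ∫⁻ t in Iic x, ENNReal.ofReal (u t) ≤
      ENNReal.ofReal (C ^ 2 * W) := by
  have hs := h.scale_pos x
  have hv := h.right.pos (-x)
  calc ENNReal.ofReal (v (-x) / s x ^ 2) * ∫⁻ t in Iic x, ENNReal.ofReal (u t)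
      ≤ ENNReal.ofReal (v (-x) / s x ^ 2) * ENNReal.ofReal (C * (u x * s x)) := by
        gcongr
        exact h.left.lintegral_le x
    _ = ENNReal.ofReal (C * (u x * v (-x) / s x)) := by
        rw [← ENNReal.ofReal_mul (by positivity)]
        congr 1
        field_simp
    _ ≤ ENNReal.ofReal (C ^ 2 * W) := ENNReal.ofReal_le_ofReal (h.mul_div_scale_le x)

theorem ofReal_mul_lintegral_Ici_le (h : IsGreenPair q s u u' v v' W C) (t : ℝ) :
    ENNReal.ofReal (u t) * ∫⁻ x in Ici t, ENNReal.ofReal (v (-x) / s x ^ 2) ≤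
      ENNReal.ofReal (C ^ 2 * W) := by
  have hreflect : ∫⁻ x in Ici t, ENNReal.ofReal (v (-x) / s x ^ 2) =
      ∫⁻ x in Iic (-t), ENNReal.ofReal (v x / s (-x) ^ 2) := by
    have := (Measure.measurePreserving_neg (volume : Measure ℝ)).setLIntegral_comp_preimage_emb
      (Homeomorph.neg ℝ).measurableEmbedding
      (fun x => ENNReal.ofReal (v x / s (-x) ^ 2)) (Iic (-t))
    simpa using this
  calc ENNReal.ofReal (u t) * ∫⁻ x in Ici t, ENNReal.ofReal (v (-x) / s x ^ 2)
      ≤ ENNReal.ofReal (u t) * ENNReal.ofReal (C * (v (-t) / s (-(-t)))) := by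
        rw [hreflect]
        gcongr
        exact h.right.lintegral_div_sq_le (-t)
    _ = ENNReal.ofReal (C * (u t * v (-t) / s t)) := by
        rw [← ENNReal.ofReal_mul (h.left.pos t).le, neg_neg]
        ring_nf
    _ ≤ ENNReal.ofReal (C ^ 2 * W) := ENNReal.ofReal_le_ofReal (h.mul_div_scale_le t)

theorem eLpNorm_half_le (h : IsGreenPair q s u u' v v' W C) (hp : 1 ≤ p)
    (hf : AEStronglyMeasurable f volume) :
    eLpNorm (fun x => v (-x) / s x ^ 2 * ∫ t in Iic x, u t * f t) p volume ≤
      ENNReal.ofReal (C ^ 2 * W) * eLpNorm f p volume := by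
  have hu := h.left.isHomogeneousSolution.continuous
  have hv := h.right.isHomogeneousSolution.continuous
  calc eLpNorm (fun x => v (-x) / s x ^ 2 * ∫ t in Iic x, u t * f t) p volume
      ≤ eLpNorm (fun x => ENNReal.ofReal (v (-x) / s x ^ 2) *
          ∫⁻ t in Iic x, ENNReal.ofReal (u t) * ‖f t‖ₑ) p volume := by
        refine eLpNorm_mono_enorm fun x => ?_
        rw [enorm_eq_self, enorm_mul,
          Real.enorm_of_nonneg (div_pos (h.right.pos _) (pow_pos (h.scale_pos x) 2)).le]
        gcongr
        refine (enorm_integral_le_lintegral_enorm _).trans_eq (lintegral_congr fun t => ?_)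
        rw [enorm_mul, Real.enorm_of_nonneg (h.left.pos t).le]
    _ ≤ ENNReal.ofReal (C ^ 2 * W) * eLpNorm (fun x => ‖f x‖ₑ) p volume :=
        eLpNorm_mul_setLIntegral_Iic_le
          ((hv.comp continuous_neg).measurable.div
            (h.scale_continuous.pow 2).measurable).ennreal_ofReal
          hu.measurable.ennreal_ofReal h.ofReal_mul_lintegral_Iic_le h.ofReal_mul_lintegral_Ici_le
          hf.enorm hp
    _ = ENNReal.ofReal (C ^ 2 * W) * eLpNorm f p volume := by rw [eLpNorm_enorm]

theorem continuous_half (h : IsGreenPair q s u u' v v' W C)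
    (hu : ∀ x, IntegrableOn (fun t => u t * f t) (Iic x)) :
    Continuous fun x => v (-x) / s x ^ 2 * ∫ t in Iic x, u t * f t :=
  ((h.right.isHomogeneousSolution.continuous.comp continuous_neg).div (h.scale_continuous.pow 2)
    fun x => (pow_pos (h.scale_pos x) 2).ne').mul (IsPrimitive.setIntegral_Iic hu).continuous

theorem eLpNorm_greenOperator_le (h : IsGreenPair q s u u' v v' W C) (hp : 1 ≤ p)
    (hf : MemLp f p volume) :
    eLpNorm (fun x => 2 / s x ^ 2 * greenOperator u v W f x) p volume ≤
      ENNReal.ofReal (4 * C ^ 2) * eLpNorm f p volume := by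
  have hW := h.wronskian_pos
  have hneg := Measure.measurePreserving_neg (volume : Measure ℝ)
  have hf_neg : MemLp (fun x => f (-x)) p volume := hf.comp_measurePreserving hneg
  set Tl : ℝ → ℝ := fun x => v (-x) / s x ^ 2 * ∫ t in Iic x, u t * f t
  set Tr : ℝ → ℝ := fun x => u (-x) / s (-x) ^ 2 * ∫ t in Iic x, v t * f (-t)
  have hTl : Continuous Tl := h.continuous_half (h.integrableOn_mul hp hf)
  have hTr : Continuous Tr := h.reflect.continuous_half (h.reflect.integrableOn_mul hp hf_neg)
  have hsum : (fun x => 2 / s x ^ 2 * greenOperator u v W f x) =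
      (2 / W) • (Tl + Tr ∘ Neg.neg) := by
    funext x
    simp only [greenOperator, Tl, Tr, Pi.smul_apply, Pi.add_apply, Function.comp_apply, neg_neg,
      smul_eq_mul]
    ring
  have hnorm_f : eLpNorm (fun x => f (-x)) p volume = eLpNorm f p volume :=
    eLpNorm_comp_measurePreserving hf.1 hneg
  have hnorm_Tr : eLpNorm (Tr ∘ Neg.neg) p volume = eLpNorm Tr p volume :=
    eLpNorm_comp_measurePreserving hTr.aestronglyMeasurable hneg
  calc eLpNorm (fun x => 2 / s x ^ 2 * greenOperator u v W f x) p volume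
      ≤ ENNReal.ofReal (2 / W) * (eLpNorm Tl p volume + eLpNorm (Tr ∘ Neg.neg) p volume) := by
        rw [hsum, ← Real.enorm_of_nonneg (by positivity : 0 ≤ 2 / W)]
        refine eLpNorm_const_smul_le.trans ?_
        gcongr
        exact eLpNorm_add_le hTl.aestronglyMeasurable
          (hTr.comp continuous_neg).aestronglyMeasurable hp
    _ ≤ ENNReal.ofReal (2 / W) * (ENNReal.ofReal (C ^ 2 * W) * eLpNorm f p volume +
          ENNReal.ofReal (C ^ 2 * W) * eLpNorm f p volume) := by
        rw [hnorm_Tr]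
        gcongr
        · exact h.eLpNorm_half_le hp hf.1
        · exact hnorm_f ▸ h.reflect.eLpNorm_half_le hp hf_neg.1
    _ = ENNReal.ofReal (4 * C ^ 2) * eLpNorm f p volume := by
        rw [← add_mul, ← ENNReal.ofReal_add (by positivity) (by positivity), ← mul_assoc,
          ← ENNReal.ofReal_mul (by positivity)]
        congr 2
        field_simp
        ring

theorem isWeight_two_div_sq (h : IsGreenPair q s u u' v v' W C) :
    IsWeight fun x => 2 / s x ^ 2 :=
  ⟨continuous_const.div (h.scale_continuous.pow 2) fun x => (pow_pos (h.scale_pos x) 2).ne',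
    fun x => div_pos two_pos (pow_pos (h.scale_pos x) 2)⟩

theorem exists_isSolution (h : IsGreenPair q s u u' v v' W C) (hp : 1 ≤ p)
    (hf : MemLp f p volume) :
    ∃ y, IsSolution q f y ∧ MemWeightedLp p (fun x => 2 / s x ^ 2) y ∧
      weightedNorm p (fun x => 2 / s x ^ 2) y ≤
        ENNReal.ofReal (4 * C ^ 2) * eLpNorm f p volume := by
  have hy := h.isSolution_greenOperator (h.integrableOn_mul hp hf) <|
    h.reflect.integrableOn_mul hp <|
      hf.comp_measurePreserving (Measure.measurePreserving_neg volume)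
  have hnorm := h.eLpNorm_greenOperator_le hp hf
  refine ⟨_, hy, ⟨fun K hK => ?_, ?_, ?_⟩, hnorm⟩
  · obtain ⟨M, hM⟩ := hK.exists_bound_of_continuousOn hy.1.continuous.continuousOn
    have : IsFiniteMeasure (volume.restrict K) := ⟨by simpa using hK.measure_lt_top⟩
    exact MemLp.of_bound hy.1.continuous.aestronglyMeasurable M
      ((ae_restrict_mem hK.measurableSet).mono hM)
  · exact (h.isWeight_two_div_sq.1.mul hy.1.continuous).aestronglyMeasurable
  · exact hnorm.trans_lt (ENNReal.mul_lt_top ENNReal.ofReal_lt_top hf.2)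

theorem admissible (h : IsGreenPair q s u u' v v' W C) (hq0 : ∀ᵐ x : ℝ, 0 ≤ q x) (hp : 1 ≤ p) :
    Admissible q p (fun x => 2 / s x ^ 2) fun _ => 1 := by
  have hp0 : p ≠ 0 := (zero_lt_one.trans_le hp).ne'
  refine ⟨h.isWeight_two_div_sq, ⟨continuous_const, fun _ => one_pos⟩, fun f hf => ?_,
    4 * C ^ 2, mul_pos four_pos (pow_pos h.const_pos 2), fun f y hf hy hym => ?_⟩
  all_goals
    obtain ⟨z, hz, hzm, hnorm⟩ := h.exists_isSolution hp
      (by simpa only [one_mul] using hf.2 : MemLp f p volume)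
  · exact ⟨z, ⟨hz, hzm⟩, fun y hy => h.eq_of_isSolution hq0 hp0 hy.1 hz hy.2.2 hzm.2⟩
  · rw [h.eq_of_isSolution hq0 hp0 hy hz hym.2 hzm.2]
    simpa only [weightedNorm, one_mul] using hnorm

end IsGreenPair

end SturmLiouville

theorem theorem4p9_general {q : ℝ → ℝ} (hq : LocallyIntegrable q volume)
    (hq0 : ∀ᵐ x : ℝ, 0 ≤ q x) (ht : SturmLiouville.PositiveTails q) {p : ℝ≥0∞} (hp : 1 ≤ p) :
    ((∀ M : ℝ, ∃ x : ℝ, M < SturmLiouville.d q x) →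
      ¬ SturmLiouville.Admissible q p (fun _ => 1) (fun _ => 1)) ∧
    (SturmLiouville.InClassH q →
      SturmLiouville.Admissible q p (SturmLiouville.qStar q) (fun _ => 1)) := by
  refine ⟨fun hd => SturmLiouville.not_admissible_one hq hq0 ht hd (zero_lt_one.trans_le hp).ne',
    fun hH => ?_⟩
  obtain ⟨u, u', v, v', W, C, h⟩ := SturmLiouville.exists_isGreenPair hq hq0 ht hH
  rw [SturmLiouville.qStar_eq_two_div_sq]
  exact h.admissible hq0 hp

theorem theorem4p9 (q : ℝ → ℝ)
    (hq : LocallyIntegrable q volume) (hq0 : ∀ᵐ x : ℝ, 0 ≤ q x)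
    (ht : SturmLiouville.PositiveTails q)
    (hH : SturmLiouville.InClassH q)
    (hd : ∀ M : ℝ, ∃ x : ℝ, M < SturmLiouville.d q x)
    (hleft : ∫⁻ x in Iic (0 : ℝ), ENNReal.ofReal (SturmLiouville.qStar q x) = ∞)
    (hright : ∫⁻ x in Ici (0 : ℝ), ENNReal.ofReal (SturmLiouville.qStar q x) = ∞) :
    (∀ p : ℝ≥0∞, 1 ≤ p → p < ∞ →
      ¬ SturmLiouville.Admissible q p (fun _ => 1) (fun _ => 1)) ∧
    (∀ p : ℝ≥0∞, 1 ≤ p → p < ∞ →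
      SturmLiouville.Admissible q p (SturmLiouville.qStar q) (fun _ => 1)) := by
  exact ⟨fun p hp _ => (theorem4p9_general hq hq0 ht hp).1 hd,
    fun p hp _ => (theorem4p9_general hq hq0 ht hp).2 hH⟩
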